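/- For $\tau$ in the upper half plane $\mathbb H$ and $q^r=e^{2\pi i r\tau}$ let $\theta_2(\tau)=\sum_{n\in\mathbb Z}q^{\frac12(n+\frac12)^2}$, $\theta_3(\tau)=\sum_{n\in\mathbb Z}q^{\frac12n^2}$, $\theta_4(\tau)=\sum_{n\in\mathbb Z}(-1)^nq^{\frac12n^2}$, and put $x_j=\theta_j^4$, $\sqrt{x_j}=\theta_j^2$ for $j=2,3,4$. For a congruence subgroup $\Gamma\subset \mathrm{SL}(2,\mathbb Z)$ let $M_k(\Gamma)$ be the space of (holomorphic) modular forms of weight $k$ for $\Gamma$ and $M(\Gamma)=\bigoplus_k M_k(\Gamma)$ the graded $\mathbb C$-algebra of modular forms. Let $\Gamma^1(4)$ be the group of matrices $\begin{pmatrix}a&b\\c&d\end{pmatrix}\in\mathrm{SL}(2,\mathbb Z)$ with $b\equiv0$ and $a\equiv d\equiv1 \pmod 4$. Let $$\Upsilon_k=\{\phi\in M_k(\Gamma_1(4)\cap\Gamma(2)) : \phi(\tau+1)=(-1)^k\phi(\tau)\},\qquad \Upsilon=\bigoplus_{k\ge0}\Upsilon_k\subset M(\Gamma_1(4)\cap\Gamma(2)),$$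 and let $\kappa_k:M_k(\Gamma^1(4))\to\Upsilon_k$ be the linear map $$(\kappa_k\widetilde\phi)(\tau)=\tau^{-k}\,\widetilde\phi\!\left(\frac{2\tau-1}{\tau}\right).$$ **Lemma.** The functions $\tilde\epsilon_1=\sqrt{x_2}+\sqrt{x_3}$ and $\tilde\epsilon_2=x_2+x_3$ are modular forms for $\Gamma^1(4)$ of weights $1$ and $2$ and generate the $\mathbb C$-algebra $M(\Gamma^1(4))$. The functions $\hat\epsilon_1=\sqrt{x_3}-\sqrt{x_4}$ and $\hat\epsilon_2=x_3+x_4$ lie in $\Upsilon_1$ and $\Upsilon_2$ respectively, and $$\kappa_1(\tilde\epsilon_1)=-i\,\hat\epsilon_1,\qquad \kappa_2(\tilde\epsilon_2)=-\hat\epsilon_2 .$$ The $\mathbb C$-algebra $\Upsilon$ is generated by $\hat\epsilon_1$ and $\hat\epsilon_2$. -/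

import Mathlib

open scoped UpperHalfPlane ModularForm MatrixGroups DirectSum Manifold
open UpperHalfPlane

noncomputable section

namespace ThetaRings

/-- The group `Γ¹(N)` of matrices `(a b; c d)` in `SL(2, ℤ)` with `b ≡ 0` and `a, d ≡ 1` modulo
`N`. -/
def GammaUpper1 (N : ℕ) : Subgroup SL(2, ℤ) where
  carrier := {g | (g 0 0 : ZMod N) = 1 ∧ (g 1 1 : ZMod N) = 1 ∧ (g 0 1 : ZMod N) = 0}
  one_mem' := by simp
  mul_mem' {a b} ha hb := by
    obtain ⟨h1, h2, h3⟩ := ha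
    obtain ⟨h4, h5, h6⟩ := hb
    simp [Matrix.mul_apply, Fin.sum_univ_two, h1, h2, h3, h4, h5, h6]
  inv_mem' {a} ha := by
    obtain ⟨h1, h2, h3⟩ := ha
    rw [Matrix.SpecialLinearGroup.SL2_inv_expl a]
    change ((a 1 1 : ℤ) : ZMod N) = 1 ∧ ((a 0 0 : ℤ) : ZMod N) = 1 ∧ ((-a 0 1 : ℤ) : ZMod N) = 0
    exact ⟨h2, h1, by rw [Int.cast_neg, h3, neg_zero]⟩

/-- The group `Γ₁(4) ∩ Γ(2)`. -/
def Gamma14Two : Subgroup SL(2, ℤ) :=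
  CongruenceSubgroup.Gamma1 4 ⊓ CongruenceSubgroup.Gamma 2

/-- `M_k(Γ)`, for a subgroup `Γ` of `SL(2, ℤ)`. -/
abbrev MF (Γ : Subgroup SL(2, ℤ)) (k : ℤ) : Type :=
  ModularForm (Γ.map (Matrix.SpecialLinearGroup.mapGL ℝ)) k

/-- The graded `ℂ`-algebra `M(Γ) = ⨁ₖ M_k(Γ)`. -/
abbrev MFRing (Γ : Subgroup SL(2, ℤ)) : Type := ⨁ k : ℤ, MF Γ k

/-- The theta constant `θ₂(τ) = ∑ₙ q ^ ((n + 1/2)² / 2)`, where `q ^ r = exp (2 π i r τ)`. -/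
def theta2 (τ : ℍ) : ℂ :=
  ∑' n : ℤ, Complex.exp (2 * Real.pi * Complex.I * (1 / 2 * ((n : ℂ) + 1 / 2) ^ 2) * (τ : ℂ))

/-- The theta constant `θ₃(τ) = ∑ₙ q ^ (n² / 2)`. -/
def theta3 (τ : ℍ) : ℂ :=
  ∑' n : ℤ, Complex.exp (2 * Real.pi * Complex.I * (1 / 2 * (n : ℂ) ^ 2) * (τ : ℂ))

/-- The theta constant `θ₄(τ) = ∑ₙ (-1) ^ n q ^ (n² / 2)`. -/
def theta4 (τ : ℍ) : ℂ :=
  ∑' n : ℤ, (-1 : ℂ) ^ n *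
    Complex.exp (2 * Real.pi * Complex.I * (1 / 2 * (n : ℂ) ^ 2) * (τ : ℂ))

/-- `x₂ = θ₂⁴`. -/
def x2 (τ : ℍ) : ℂ := theta2 τ ^ 4

/-- `x₃ = θ₃⁴`. -/
def x3 (τ : ℍ) : ℂ := theta3 τ ^ 4

/-- `x₄ = θ₄⁴`. -/
def x4 (τ : ℍ) : ℂ := theta4 τ ^ 4

/-- The holomorphic square root `√x₂ = θ₂²`. -/
def sqrtx2 (τ : ℍ) : ℂ := theta2 τ ^ 2

/-- The holomorphic square root `√x₃ = θ₃²`. -/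
def sqrtx3 (τ : ℍ) : ℂ := theta3 τ ^ 2

/-- The holomorphic square root `√x₄ = θ₄²`. -/
def sqrtx4 (τ : ℍ) : ℂ := theta4 τ ^ 2

/-- `Υ_k`: the forms `φ` in `M_k(Γ₁(4) ∩ Γ(2))` with `φ(τ + 1) = (-1)ᵏ φ(τ)`. -/
def Upsilon (k : ℤ) : Submodule ℂ (MF Gamma14Two k) where
  carrier := {φ | ∀ τ : ℍ, φ ((1 : ℝ) +ᵥ τ) = (-1 : ℂ) ^ k * φ τ}
  zero_mem' := fun τ => by simp
  add_mem' {f g} hf hg := fun τ => by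
    change f _ + g _ = _ * (f τ + g τ)
    rw [hf τ, hg τ, mul_add]
  smul_mem' c f hf := fun τ => by
    change c * f _ = _ * (c * f τ)
    rw [hf τ]; ring

/-- The graded algebra `Υ = ⨁_{k ≥ 0} Υ_k`, inside `M(Γ₁(4) ∩ Γ(2))`. -/
def UpsilonRing : Subalgebra ℂ (MFRing Gamma14Two) where
  carrier := {x | (∀ k : ℤ, 0 ≤ k → x k ∈ Upsilon k) ∧ ∀ k : ℤ, k < 0 → x k = 0}
  add_mem' {x y} hx hy :=
    ⟨fun k hk => (Upsilon k).add_mem (hx.1 k hk) (hy.1 k hk), fun k hk => by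
      rw [DirectSum.add_apply, hx.2 k hk, hy.2 k hk, add_zero]⟩
  mul_mem' {x y} hx hy := by
    classical
    -- it suffices to look at products of homogeneous components
    let P : AddSubmonoid (MFRing Gamma14Two) :=
      { carrier := {x | (∀ k : ℤ, 0 ≤ k → x k ∈ Upsilon k) ∧ ∀ k : ℤ, k < 0 → x k = 0}
        zero_mem' := ⟨fun k _ => (Upsilon k).zero_mem, fun _ _ => rfl⟩
        add_mem' := fun {x y} hx hy =>
          ⟨fun k hk => (Upsilon k).add_mem (hx.1 k hk) (hy.1 k hk), fun k hk => by
            rw [DirectSum.add_apply, hx.2 k hk, hy.2 k hk, add_zero]⟩ }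
    change x * y ∈ P
    rw [← DirectSum.sum_support_of x, ← DirectSum.sum_support_of y, Finset.sum_mul_sum]
    refine P.sum_mem fun i _ => P.sum_mem fun j _ => ?_
    rcases lt_or_ge i 0 with hi | hi
    · rw [hx.2 i hi, map_zero, zero_mul]; exact P.zero_mem
    rcases lt_or_ge j 0 with hj | hj
    · rw [hy.2 j hj, map_zero, mul_zero]; exact P.zero_mem
    rw [DirectSum.of_mul_of]
    refine ⟨fun k _ => ?_, fun k hk => DirectSum.of_eq_of_ne _ _ _ (by omega)⟩
    by_cases hk : k = i + j
    · subst hk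
      rw [DirectSum.of_eq_same]
      intro τ
      change (x i) _ * (y j) _ = _ * ((x i) τ * (y j) τ)
      rw [hx.1 i hi τ, hy.1 j hj τ, zpow_add₀ (by norm_num)]
      ring
    · rw [DirectSum.of_eq_of_ne _ _ _ hk]
      exact (Upsilon k).zero_mem
  algebraMap_mem' c := by
    change (∀ k : ℤ, 0 ≤ k → (DirectSum.of (MF Gamma14Two) 0 (ModularForm.const c)) k ∈ Upsilon k) ∧
      ∀ k : ℤ, k < 0 → (DirectSum.of (MF Gamma14Two) 0 (ModularForm.const c)) k = 0
    refine ⟨fun k _ => ?_, fun k hk => DirectSum.of_eq_of_ne _ _ _ (by omega)⟩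
    by_cases hk : k = 0
    · subst hk
      rw [DirectSum.of_eq_same]
      intro τ
      change c = _ * c
      simp
    · rw [DirectSum.of_eq_of_ne _ _ _ hk]
      exact (Upsilon k).zero_mem

/-- The point `(2τ - 1) / τ = 2 - 1 / τ` of the upper half plane. -/
def kappaPoint (τ : ℍ) : ℍ :=
  ⟨(2 * (τ : ℂ) - 1) / (τ : ℂ), by
    have h : (2 * (τ : ℂ) - 1) / (τ : ℂ) = 2 - (τ : ℂ)⁻¹ := by
      field_simp [τ.ne_zero]
    rw [h, Complex.sub_im, Complex.inv_im]
    have h1 : 0 < (τ : ℂ).im := τ.im_pos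
    have h2 : 0 < Complex.normSq (τ : ℂ) := Complex.normSq_pos.2 τ.ne_zero
    have h3 := div_pos h1 h2
    have h4 : (2 : ℂ).im = 0 := rfl
    rw [h4, neg_div]; linarith⟩

/-- The matrix `(2 -1; 1 0)`, which acts on the upper half plane by `τ ↦ (2τ - 1) / τ`. -/
def kappaMatrix : SL(2, ℤ) := ⟨!![2, -1; 1, 0], by simp [Matrix.det_fin_two]⟩

theorem kappaMatrix_smul (τ : ℍ) : kappaMatrix • τ = kappaPoint τ := by
  apply UpperHalfPlane.ext
  rw [UpperHalfPlane.coe_specialLinearGroup_apply]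
  change (((2 : ℤ) : ℝ) * (τ : ℂ) + ((-1 : ℤ) : ℝ)) / (((1 : ℤ) : ℝ) * (τ : ℂ) + ((0 : ℤ) : ℝ)) =
    (2 * (τ : ℂ) - 1) / (τ : ℂ)
  push_cast
  ring_nf

theorem slash_kappaMatrix (k : ℤ) (f : ℍ → ℂ) :
    f ∣[k] kappaMatrix = fun τ : ℍ => (τ : ℂ) ^ (-k) * f (kappaPoint τ) := by
  ext τ
  rw [ModularForm.SL_slash_apply, kappaMatrix_smul, mul_comm]
  congr 2
  change ((((1 : ℤ) : ℝ) : ℂ) * (τ : ℂ) + (((0 : ℤ) : ℝ) : ℂ)) = (τ : ℂ)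
  push_cast
  ring

theorem kappaMatrix_conj_mem {A : SL(2, ℤ)} (hA : A ∈ Gamma14Two) :
    kappaMatrix * A * kappaMatrix⁻¹ ∈ GammaUpper1 4 := by
  obtain ⟨h4, h2⟩ := hA
  have h4' := (CongruenceSubgroup.Gamma1_mem 4 A).1 h4
  have h2' := CongruenceSubgroup.Gamma_mem.1 h2
  have hi : ((kappaMatrix * A * kappaMatrix⁻¹ : SL(2, ℤ)) : Matrix (Fin 2) (Fin 2) ℤ) =
      !![A 1 1 - 2 * A 0 1, 2 * A 0 0 - A 1 0 + 4 * A 0 1 - 2 * A 1 1;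
        -A 0 1, A 0 0 + 2 * A 0 1] := by
    rw [Matrix.SpecialLinearGroup.coe_mul, Matrix.SpecialLinearGroup.coe_mul,
      Matrix.SpecialLinearGroup.coe_inv,
      show (kappaMatrix : Matrix (Fin 2) (Fin 2) ℤ) = !![2, -1; 1, 0] from rfl,
      Matrix.adjugate_fin_two_of, Matrix.eta_fin_two (A : Matrix (Fin 2) (Fin 2) ℤ),
      Matrix.mul_fin_two, Matrix.mul_fin_two]
    ext i j
    fin_cases i <;> fin_cases j <;> simp <;> ring
  obtain ⟨ha, hd, hc⟩ := h4'
  obtain ⟨-, hb, -, -⟩ := h2'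
  obtain ⟨b, hb⟩ := (ZMod.intCast_zmod_eq_zero_iff_dvd _ _).1 hb
  have h4 : (4 : ZMod 4) = 0 := rfl
  have h22 : (2 : ZMod 4) * 2 = 0 := rfl
  change ((_ : ℤ) : ZMod 4) = 1 ∧ ((_ : ℤ) : ZMod 4) = 1 ∧ ((_ : ℤ) : ZMod 4) = 0
  rw [hi]
  simp only [Matrix.of_apply, Matrix.cons_val', Matrix.cons_val_zero, Matrix.cons_val_one,
    Matrix.cons_val_fin_one, hb]
  push_cast
  rw [ha, hc, hd]
  refine ⟨?_, ?_, ?_⟩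
  · linear_combination (-(b : ZMod 4)) * h22
  · linear_combination (b : ZMod 4) * h22
  · linear_combination (2 * (b : ZMod 4)) * h4

/-- The matrix `(1 -4; 1 -3)`. -/
def kappaShift : SL(2, ℤ) := ⟨!![1, -4; 1, -3], by simp [Matrix.det_fin_two]⟩

theorem kappaShift_mem : kappaShift ∈ GammaUpper1 4 := by
  change ((1 : ℤ) : ZMod 4) = 1 ∧ ((-3 : ℤ) : ZMod 4) = 1 ∧ ((-4 : ℤ) : ZMod 4) = 0
  decide

theorem coe_one_vadd (τ : ℍ) : (((1 : ℝ) +ᵥ τ : ℍ) : ℂ) = 1 + (τ : ℂ) := by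
  rw [UpperHalfPlane.coe_vadd, Complex.ofReal_one]

theorem kappaShift_smul (τ : ℍ) : kappaShift • kappaPoint τ = kappaPoint ((1 : ℝ) +ᵥ τ) := by
  apply UpperHalfPlane.ext
  rw [UpperHalfPlane.coe_specialLinearGroup_apply]
  have h1 : (1 + (τ : ℂ)) ≠ 0 := coe_one_vadd τ ▸ ((1 : ℝ) +ᵥ τ).ne_zero
  have h0 := τ.ne_zero
  change ((((1 : ℤ) : ℝ) : ℂ) * ((2 * (τ : ℂ) - 1) / (τ : ℂ)) + (((-4 : ℤ) : ℝ) : ℂ)) /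
      ((((1 : ℤ) : ℝ) : ℂ) * ((2 * (τ : ℂ) - 1) / (τ : ℂ)) + (((-3 : ℤ) : ℝ) : ℂ)) =
    (2 * (((1 : ℝ) +ᵥ τ : ℍ) : ℂ) - 1) / (((1 : ℝ) +ᵥ τ : ℍ) : ℂ)
  rw [coe_one_vadd]
  push_cast
  have h2 : 1 * ((2 * (τ : ℂ) - 1) / (τ : ℂ)) + -3 = -(1 + (τ : ℂ)) / (τ : ℂ) := by
    field_simp; ring
  rw [h2]
  field_simp
  ring

/-- The function `κ_k φ` gets the sign `(-1)ᵏ` under `τ ↦ τ + 1`. -/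
theorem kappa_shift (k : ℤ) (φ : MF (GammaUpper1 4) k) (τ : ℍ) :
    (((1 : ℝ) +ᵥ τ : ℍ) : ℂ) ^ (-k) * φ (kappaPoint ((1 : ℝ) +ᵥ τ)) =
      (-1 : ℂ) ^ k * ((τ : ℂ) ^ (-k) * φ (kappaPoint τ)) := by
  have h := φ.slash_action_eq' _ (Subgroup.mem_map_of_mem _ kappaShift_mem)
  change (φ : ℍ → ℂ) ∣[k] kappaShift = (φ : ℍ → ℂ) at h
  have h' := (ModularForm.slash_action_eq'_iff k φ kappaShift (kappaPoint τ)).1 (congrFun h _)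
  rw [← kappaShift_smul, h', coe_one_vadd]
  have h1 : (1 + (τ : ℂ)) ≠ 0 := coe_one_vadd τ ▸ ((1 : ℝ) +ᵥ τ).ne_zero
  have h0 := τ.ne_zero
  change (1 + (τ : ℂ)) ^ (-k) * ((((1 : ℤ) : ℂ) * ((2 * (τ : ℂ) - 1) / (τ : ℂ)) +
    ((-3 : ℤ) : ℂ)) ^ k * φ (kappaPoint τ)) = _
  have h2 : ((1 : ℤ) : ℂ) * ((2 * (τ : ℂ) - 1) / (τ : ℂ)) + ((-3 : ℤ) : ℂ) =
      (1 + (τ : ℂ)) * (-1 * (τ : ℂ)⁻¹) := by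
    push_cast; field_simp; ring
  rw [h2, mul_zpow, mul_zpow, zpow_neg, zpow_neg, inv_zpow, ← mul_assoc, ← mul_assoc,
    inv_mul_cancel₀ (zpow_ne_zero k h1), one_mul, mul_assoc]

/-- The linear map `κ_k : M_k(Γ¹(4)) → Υ_k` with `(κ_k φ)(τ) = τ⁻ᵏ φ((2τ - 1) / τ)`. -/
def kappa (k : ℤ) : MF (GammaUpper1 4) k →ₗ[ℂ] Upsilon k where
  toFun φ := ⟨{
    toFun := fun τ => (τ : ℂ) ^ (-k) * φ (kappaPoint τ)
    slash_action_eq' := by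
      rintro _ ⟨A, hA, rfl⟩
      rw [← slash_kappaMatrix]
      change ((φ : ℍ → ℂ) ∣[k] kappaMatrix) ∣[k] A = (φ : ℍ → ℂ) ∣[k] kappaMatrix
      have h := φ.slash_action_eq' _ (Subgroup.mem_map_of_mem _ (kappaMatrix_conj_mem hA))
      change (φ : ℍ → ℂ) ∣[k] (kappaMatrix * A * kappaMatrix⁻¹) = (φ : ℍ → ℂ) at h
      conv_rhs => rw [← h]
      rw [← SlashAction.slash_mul, ← SlashAction.slash_mul, inv_mul_cancel_right]
    holo' := by
      change MDiff (fun τ : ℍ => (τ : ℂ) ^ (-k) * φ (kappaPoint τ))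
      rw [← slash_kappaMatrix]
      exact (ModularFormClass.holo φ).slash k _
    bdd_at_cusps' := by
      intro c hc
      rw [← slash_kappaMatrix]
      change c.IsBoundedAt ((φ : ℍ → ℂ) ∣[k] Matrix.SpecialLinearGroup.mapGL ℝ kappaMatrix) k
      rw [← OnePoint.IsBoundedAt.smul_iff]
      refine φ.bdd_at_cusps' ((hc.smul _).mono ?_)
      rintro _ ⟨_, ⟨A, hA, rfl⟩, rfl⟩
      refine ⟨kappaMatrix * A * kappaMatrix⁻¹, kappaMatrix_conj_mem hA, ?_⟩
      rw [map_mul, map_mul, map_inv]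
      rfl }, kappa_shift k φ⟩
  map_add' f g := by
    apply Subtype.ext
    apply ModularForm.ext
    intro τ
    exact mul_add _ _ _
  map_smul' c f := by
    apply Subtype.ext
    apply ModularForm.ext
    intro τ
    exact mul_left_comm _ _ _

end ThetaRings

end

/-! The curve of Γ¹(4) has three cusps, represented by ∞ (width 4), 0 and 2. The weight-two form
√x₂√x₃ has no zeros on ℍ, vanishes to first order in q^{1/4} at ∞, and has nonzero limits at the
other two cusps. Given f of weight k ≥ 0 with value c at ∞, the form f - c ε̃₁^k vanishes at ∞,
because ε̃₁ tends to 1 there; so it is √x₂√x₃ times a form of weight k - 2. Since √x₂√x₃ = (ε̃₁² -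
ε̃₂)/2 and forms of negative weight are zero, descent on the weight shows that ε̃₁ and ε̃₂ generate
(`exists_eq_mul_of_isZeroAtImInfty`, `of_mem_adjoin_epsilon`).

The absence of zeros comes from level one: (θ₂θ₃θ₄)⁸ is a cusp form of weight 12, hence a nonzero
multiple of the discriminant (`thetaProd_ne_zero`). Invariance under Γ¹(4) is checked on the
generators T⁴ and (1 0; 1 1) (`GammaUpper1_four_le`), and boundedness on one representative per cusp
(`exists_GammaUpper1_four_mul`).

For Υ, the map κ_k is the slash action of the matrix (2 -1; 1 0). Conjugation by it matches
invariance under Γ¹(4) with the conditions defining Υ_k, so κ_k is onto (`kappa_surjective`). The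
κ_k form an algebra homomorphism with image Υ that sends ε̃₁, ε̃₂ to unit multiples of ε̂₁, ε̂₂. -/

noncomputable section
namespace ThetaRings

open Filter Topology ModularGroup Matrix.SpecialLinearGroup

/-! ### Theta constants: transformation under T and S, holomorphy, behaviour at i∞. -/

section Theta

open Complex

theorem theta3_eq_jacobiTheta₂ (τ : ℍ) : theta3 τ = jacobiTheta₂ 0 τ :=
  tsum_congr fun n => by
    rw [jacobiTheta₂_term]
    ring_nf

theorem exp_pi_mul_I_mul_int (n : ℤ) : cexp (Real.pi * Complex.I * n) = (-1) ^ n := by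
  rw [mul_comm, exp_int_mul, exp_pi_mul_I]

theorem theta4_eq_jacobiTheta₂ (τ : ℍ) : theta4 τ = jacobiTheta₂ (1 / 2) τ :=
  tsum_congr fun n => by
    rw [jacobiTheta₂_term, ← exp_pi_mul_I_mul_int, ← Complex.exp_add]
    ring_nf

theorem theta2_eq_jacobiTheta₂ (τ : ℍ) :
    theta2 τ = cexp (Real.pi * Complex.I * τ / 4) * jacobiTheta₂ (τ / 2) τ := by
  rw [theta2, jacobiTheta₂, ← tsum_mul_left]
  refine tsum_congr fun n => ?_
  rw [jacobiTheta₂_term, ← Complex.exp_add]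
  ring_nf

/-- n and n² have the same parity. This is why T exchanges θ₃ and θ₄. -/
theorem exp_pi_mul_I_mul_int_sq (n : ℤ) : cexp (Real.pi * Complex.I * (n : ℂ) ^ 2) = (-1) ^ n := by
  have h := exp_pi_mul_I_mul_int (n ^ 2)
  push_cast at h
  rw [h]
  rcases Int.even_or_odd n with hn | hn
  · rw [hn.neg_one_zpow, (hn.pow_of_ne_zero two_ne_zero).neg_one_zpow]
  · rw [hn.neg_one_zpow, hn.pow.neg_one_zpow]

theorem theta3_one_vadd (τ : ℍ) : theta3 ((1 : ℝ) +ᵥ τ) = theta4 τ :=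
  tsum_congr fun n => by
    rw [coe_one_vadd, ← exp_pi_mul_I_mul_int_sq, ← Complex.exp_add]
    ring_nf

theorem theta4_one_vadd (τ : ℍ) : theta4 ((1 : ℝ) +ᵥ τ) = theta3 τ :=
  tsum_congr fun n => by
    rw [coe_one_vadd, mul_add, Complex.exp_add, mul_one,
      show 2 * (Real.pi : ℂ) * Complex.I * (1 / 2 * (n : ℂ) ^ 2) =
        Real.pi * Complex.I * (n : ℂ) ^ 2 by ring,
      exp_pi_mul_I_mul_int_sq, ← mul_assoc, ← mul_zpow]
    simp

theorem theta2_one_vadd (τ : ℍ) :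
    theta2 ((1 : ℝ) +ᵥ τ) = cexp (Real.pi * Complex.I / 4) * theta2 τ := by
  rw [theta2, theta2, ← tsum_mul_left]
  refine tsum_congr fun n => ?_
  -- (n + 1/2)² = n² + n + 1/4 with n² + n even, so only the eighth root of unity from 1/4 survives.
  have h : cexp (Real.pi * Complex.I * (n : ℂ) ^ 2 + Real.pi * Complex.I * n) = 1 := by
    rw [Complex.exp_add, exp_pi_mul_I_mul_int_sq, exp_pi_mul_I_mul_int, ← mul_zpow]
    simp
  calc
    _ = cexp (Real.pi * Complex.I / 4) *
        cexp (2 * Real.pi * Complex.I * (1 / 2 * ((n : ℂ) + 1 / 2) ^ 2) * τ) *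
        cexp (Real.pi * Complex.I * (n : ℂ) ^ 2 + Real.pi * Complex.I * n) := by
      rw [coe_one_vadd, ← Complex.exp_add, ← Complex.exp_add]
      ring_nf
    _ = _ := by rw [h, mul_one]

theorem sqrtx2_one_vadd (τ : ℍ) : sqrtx2 ((1 : ℝ) +ᵥ τ) = Complex.I * sqrtx2 τ := by
  rw [sqrtx2, sqrtx2, theta2_one_vadd, mul_pow, ← Complex.exp_nat_mul]
  congr 1
  refine Eq.trans (congrArg _ ?_) Complex.exp_pi_div_two_mul_I
  push_cast
  ring

theorem sqrtx3_one_vadd (τ : ℍ) : sqrtx3 ((1 : ℝ) +ᵥ τ) = sqrtx4 τ := by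
  rw [sqrtx3, sqrtx4, theta3_one_vadd]

theorem sqrtx4_one_vadd (τ : ℍ) : sqrtx4 ((1 : ℝ) +ᵥ τ) = sqrtx3 τ := by
  rw [sqrtx3, sqrtx4, theta4_one_vadd]

theorem coe_S_smul (τ : ℍ) : ((S • τ : ℍ) : ℂ) = -1 / τ := by
  rw [modular_S_smul]
  change (-(τ : ℂ))⁻¹ = _
  rw [inv_neg, neg_div, one_div]

theorem neg_I_mul_cpow_half_ne_zero (τ : ℍ) : (-Complex.I * (τ : ℂ)) ^ (1 / 2 : ℂ) ≠ 0 := by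
  rw [Ne, cpow_eq_zero_iff, not_and_or]
  exact Or.inl <| mul_ne_zero (neg_ne_zero.mpr I_ne_zero) τ.ne_zero

/-- Squaring removes the branch of the square root, so the θⱼ² transform with integral weight. -/
theorem neg_I_mul_cpow_half_sq (τ : ℍ) : ((-Complex.I * (τ : ℂ)) ^ (1 / 2 : ℂ)) ^ 2 =
    -Complex.I * τ := by
  rw [← cpow_nat_mul]
  norm_num

theorem theta3_S_smul (τ : ℍ) :
    theta3 (S • τ) = (-Complex.I * (τ : ℂ)) ^ (1 / 2 : ℂ) * theta3 τ := by
  rw [theta3_eq_jacobiTheta₂, theta3_eq_jacobiTheta₂, coe_S_smul,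
    jacobiTheta₂_functional_equation 0 τ]
  have := neg_I_mul_cpow_half_ne_zero τ
  generalize (-Complex.I * (τ : ℂ)) ^ (1 / 2 : ℂ) = r at *
  field_simp
  simp

/-- Jacobi inversion carries the half period τ/2 to 1/2, and its Gaussian factor cancels the
exponential prefactor of θ₂. -/
theorem theta4_S_smul (τ : ℍ) :
    theta4 (S • τ) = (-Complex.I * (τ : ℂ)) ^ (1 / 2 : ℂ) * theta2 τ := by
  have h := neg_I_mul_cpow_half_ne_zero τ
  have h0 := τ.ne_zero
  rw [theta4_eq_jacobiTheta₂, theta2_eq_jacobiTheta₂, coe_S_smul,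
    jacobiTheta₂_functional_equation (τ / 2) τ, show (τ : ℂ) / 2 / τ = 1 / 2 by field_simp,
    show -Real.pi * Complex.I * ((τ : ℂ) / 2) ^ 2 / τ =
      -(Real.pi * Complex.I * τ / 4) by field_simp; ring,
    Complex.exp_neg]
  have h1 := Complex.exp_ne_zero (Real.pi * Complex.I * τ / 4)
  generalize cexp (Real.pi * Complex.I * τ / 4) = e at *
  generalize (-Complex.I * (τ : ℂ)) ^ (1 / 2 : ℂ) = r at *
  field_simp

theorem theta2_S_smul (τ : ℍ) :
    theta2 (S • τ) = (-Complex.I * (τ : ℂ)) ^ (1 / 2 : ℂ) * theta4 τ := by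
  have h := neg_I_mul_cpow_half_ne_zero τ
  have h0 := τ.ne_zero
  rw [theta4_eq_jacobiTheta₂, theta2_eq_jacobiTheta₂, coe_S_smul,
    -- Evenness in the first variable turns 1/(2τ) into half of the new modulus -1/τ.
    jacobiTheta₂_functional_equation (1 / 2) τ, ← jacobiTheta₂_neg_left (1 / 2 / τ),
    show -(1 / 2 / (τ : ℂ)) = -1 / τ / 2 by field_simp,
    show -Real.pi * Complex.I * (1 / 2 : ℂ) ^ 2 / τ =
      Real.pi * Complex.I * (-1 / τ) / 4 by field_simp; ring]
  generalize (-Complex.I * (τ : ℂ)) ^ (1 / 2 : ℂ) = r at *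
  field_simp

theorem sqrtx2_S_smul (τ : ℍ) : sqrtx2 (S • τ) = -Complex.I * τ * sqrtx4 τ := by
  rw [sqrtx2, theta2_S_smul, mul_pow, neg_I_mul_cpow_half_sq, sqrtx4]

theorem sqrtx3_S_smul (τ : ℍ) : sqrtx3 (S • τ) = -Complex.I * τ * sqrtx3 τ := by
  rw [sqrtx3, theta3_S_smul, mul_pow, neg_I_mul_cpow_half_sq, sqrtx3]

theorem sqrtx4_S_smul (τ : ℍ) : sqrtx4 (S • τ) = -Complex.I * τ * sqrtx2 τ := by
  rw [sqrtx4, theta4_S_smul, mul_pow, neg_I_mul_cpow_half_sq, sqrtx2]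

theorem slash_T_apply (k : ℤ) (f : ℍ → ℂ) (τ : ℍ) : (f ∣[k] T) τ = f ((1 : ℝ) +ᵥ τ) := by
  rw [ModularForm.SL_slash_apply, modular_T_smul]
  have h : denom (T : SL(2, ℤ)) τ = 1 := by
    change (((0 : ℤ) : ℝ) : ℂ) * (τ : ℂ) + (((1 : ℤ) : ℝ) : ℂ) = 1
    simp
  rw [h, one_zpow, mul_one]

theorem slash_S_apply (k : ℤ) (f : ℍ → ℂ) (τ : ℍ) :
    (f ∣[k] S) τ = f (S • τ) * (τ : ℂ) ^ (-k) := by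
  rw [ModularForm.SL_slash_apply, denom_S]

theorem sqrtx3_slash_T : sqrtx3 ∣[(1 : ℤ)] T = sqrtx4 := by
  ext τ
  rw [slash_T_apply, sqrtx3_one_vadd]

theorem sqrtx4_slash_T : sqrtx4 ∣[(1 : ℤ)] T = sqrtx3 := by
  ext τ
  rw [slash_T_apply, sqrtx4_one_vadd]

theorem sqrtx2_slash_S : sqrtx2 ∣[(1 : ℤ)] S = (-Complex.I) • sqrtx4 := by
  ext τ
  have := τ.ne_zero
  rw [slash_S_apply, sqrtx2_S_smul, zpow_neg_one, Pi.smul_apply, smul_eq_mul]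
  field_simp

theorem sqrtx3_slash_S : sqrtx3 ∣[(1 : ℤ)] S = (-Complex.I) • sqrtx3 := by
  ext τ
  have := τ.ne_zero
  rw [slash_S_apply, sqrtx3_S_smul, zpow_neg_one, Pi.smul_apply, smul_eq_mul]
  field_simp

theorem mdifferentiable_theta3 : MDiff theta3 := by
  rw [UpperHalfPlane.mdifferentiable_iff]
  refine DifferentiableOn.congr (f := jacobiTheta₂ 0) (fun z hz =>
    (differentiableAt_jacobiTheta₂_snd 0 hz).differentiableWithinAt) fun z hz => ?_
  rw [Function.comp_apply, theta3_eq_jacobiTheta₂, ofComplex_apply_of_im_pos hz]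

theorem mdifferentiable_theta4 : MDiff theta4 := by
  rw [UpperHalfPlane.mdifferentiable_iff]
  refine DifferentiableOn.congr (f := jacobiTheta₂ (1 / 2)) (fun z hz =>
    (differentiableAt_jacobiTheta₂_snd _ hz).differentiableWithinAt) fun z hz => ?_
  rw [Function.comp_apply, theta4_eq_jacobiTheta₂, ofComplex_apply_of_im_pos hz]

theorem mdifferentiable_theta2 : MDiff theta2 := by
  rw [UpperHalfPlane.mdifferentiable_iff]
  refine DifferentiableOn.congr
    (f := fun z => cexp (Real.pi * Complex.I * z / 4) * jacobiTheta₂ (z / 2) z) (fun z hz => ?_)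
    fun z hz => ?_
  · refine DifferentiableAt.differentiableWithinAt (DifferentiableAt.mul (by fun_prop) ?_)
    exact (hasFDerivAt_jacobiTheta₂ (z / 2) hz).differentiableAt.comp (f := fun z => (z / 2, z))
      z (by fun_prop)
  · rw [Function.comp_apply, theta2_eq_jacobiTheta₂, ofComplex_apply_of_im_pos hz]

theorem mdifferentiable_sqrtx2 : MDiff sqrtx2 := mdifferentiable_theta2.pow 2

theorem mdifferentiable_sqrtx3 : MDiff sqrtx3 := mdifferentiable_theta3.pow 2

theorem mdifferentiable_sqrtx4 : MDiff sqrtx4 := mdifferentiable_theta4.pow 2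

theorem tendsto_theta3 : Tendsto theta3 atImInfty (𝓝 1) := by
  have h : Tendsto (fun τ : ℂ => jacobiTheta τ - 1) (comap im atTop) (𝓝 0) :=
    isBigO_at_im_infty_jacobiTheta_sub_one.trans_tendsto <|
      (Real.tendsto_exp_atBot.comp
        (tendsto_id.const_mul_atTop_of_neg (neg_neg_of_pos Real.pi_pos))).comp tendsto_comap
  have h2 : Tendsto (fun τ : ℍ => (τ : ℂ)) atImInfty (comap im atTop) :=
    tendsto_comap_iff.2 tendsto_comap
  have h3 := (h.comp h2).add_const 1
  rw [zero_add] at h3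
  refine h3.congr fun τ => ?_
  rw [theta3_eq_jacobiTheta₂, Function.comp_apply, sub_add_cancel, jacobiTheta_eq_jacobiTheta₂]

theorem tendsto_one_vadd : Tendsto (fun τ : ℍ => (1 : ℝ) +ᵥ τ) atImInfty atImInfty :=
  tendsto_comap_iff.2 <| by
    refine Tendsto.congr (fun τ => ?_) (tendsto_comap (f := UpperHalfPlane.im))
    simp

theorem tendsto_theta4 : Tendsto theta4 atImInfty (𝓝 1) :=
  (tendsto_theta3.comp tendsto_one_vadd).congr theta3_one_vadd

/-- The n-th term has norm exp(-π n(n+1) Im τ): the terms n = 0 and n = -1 are constantly 1 and all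
others decay. For Im τ ≥ 1 each term is dominated by its value at τ = i. -/
theorem tendsto_theta2 :
    Tendsto (fun τ : ℍ => jacobiTheta₂ (τ / 2) τ) atImInfty (𝓝 2) := by
  let g : ℤ → ℂ := fun n => if n = 0 ∨ n = -1 then 1 else 0
  have hg : ∑' n, g n = 2 := by
    rw [tsum_eq_sum (s := {0, -1})]
    · rw [Finset.sum_pair (by norm_num)]
      norm_num [g]
    · intro n hn
      simp only [Finset.mem_insert, Finset.mem_singleton] at hn
      exact if_neg hn
  have hnorm (n : ℤ) (τ : ℍ) : ‖jacobiTheta₂_term n (τ / 2) τ‖ =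
      Real.exp (-Real.pi * (n * (n + 1) : ℤ) * τ.im) := by
    rw [norm_jacobiTheta₂_term]
    congr 1
    have : ((τ : ℂ) / 2).im = τ.im / 2 := by
      rw [show (2 : ℂ) = ((2 : ℝ) : ℂ) by norm_num, div_ofReal_im, coe_im]
    rw [this, coe_im]
    push_cast
    ring
  have hpos (n : ℤ) : 0 ≤ n * (n + 1) := by
    rcases lt_or_ge n 0 with h | h
    · nlinarith
    · positivity
  suffices h : Tendsto (fun τ : ℍ => jacobiTheta₂ (τ / 2) τ) atImInfty (𝓝 (∑' n, g n)) by
    rwa [hg] at h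
  refine tendsto_tsum_of_dominated_convergence
    (bound := fun n => ‖jacobiTheta₂_term n ((UpperHalfPlane.I : ℍ) / 2) UpperHalfPlane.I‖)
    ?_ (fun n => ?_) ?_
  · exact ((summable_jacobiTheta₂_term_iff _ _).2 UpperHalfPlane.I.im_pos).norm
  · by_cases hn : n = 0 ∨ n = -1
    · refine Tendsto.congr (fun τ => ?_) tendsto_const_nhds
      rw [show g n = 1 from if_pos hn, jacobiTheta₂_term, eq_comm]
      rcases hn with rfl | rfl
      · simp
      · rw [show 2 * (Real.pi : ℂ) * Complex.I * ((-1 : ℤ) : ℂ) * (τ / 2) +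
          Real.pi * Complex.I * ((-1 : ℤ) : ℂ) ^ 2 * τ = 0 by push_cast; ring, Complex.exp_zero]
    · rw [show g n = 0 from if_neg hn, tendsto_zero_iff_norm_tendsto_zero]
      simp_rw [hnorm]
      have h : 0 < n * (n + 1) := by
        refine lt_of_le_of_ne (hpos n) fun h => hn ?_
        rcases mul_eq_zero.1 h.symm with h | h
        · exact Or.inl h
        · exact Or.inr (by omega)
      have h' : (0 : ℝ) < (n * (n + 1) : ℤ) := by exact_mod_cast h
      exact Real.tendsto_exp_atBot.comp
        ((tendsto_comap (f := UpperHalfPlane.im)).const_mul_atTop_of_neg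
          (mul_neg_of_neg_of_pos (neg_neg_of_pos Real.pi_pos) h'))
  · have h1 : ∀ᶠ τ in atImInfty, 1 ≤ UpperHalfPlane.im τ :=
      (tendsto_comap (f := UpperHalfPlane.im)).eventually_ge_atTop 1
    filter_upwards [h1] with τ hτ n
    rw [hnorm, hnorm, Real.exp_le_exp, UpperHalfPlane.I_im, neg_mul, neg_mul,
      neg_mul, neg_le_neg_iff]
    have := mul_nonneg Real.pi_pos.le (by exact_mod_cast hpos n : (0 : ℝ) ≤ (n * (n + 1) : ℤ))
    exact mul_le_mul_of_nonneg_left hτ this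

theorem tendsto_sqrtx3 : Tendsto sqrtx3 atImInfty (𝓝 1) := by
  rw [← one_pow 2]
  exact tendsto_theta3.pow 2

theorem tendsto_sqrtx4 : Tendsto sqrtx4 atImInfty (𝓝 1) := by
  rw [← one_pow 2]
  exact tendsto_theta4.pow 2

theorem sqrtx2_eq (τ : ℍ) :
    sqrtx2 τ = cexp (Real.pi * Complex.I * τ / 2) * jacobiTheta₂ (τ / 2) τ ^ 2 := by
  rw [sqrtx2, theta2_eq_jacobiTheta₂, mul_pow, ← Complex.exp_nat_mul]
  congr 2
  push_cast
  ring

/-- The exponent is written as -2π Im τ / 4 to agree with the decay rate of a form of period 4. -/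
theorem norm_exp_pi_mul_I_mul (τ : ℍ) :
    ‖cexp (Real.pi * Complex.I * τ / 2)‖ = Real.exp (-2 * Real.pi * τ.im / 4) := by
  rw [Complex.norm_exp]
  congr 1
  rw [show (Real.pi : ℂ) * Complex.I * τ / 2 =
      ((Real.pi / 2 : ℝ) : ℂ) * τ * Complex.I by push_cast; ring,
    mul_I_re, im_ofReal_mul, coe_im]
  ring

theorem tendsto_sqrtx2 : Tendsto sqrtx2 atImInfty (𝓝 0) := by
  have h : Tendsto (fun τ : ℍ => cexp (Real.pi * Complex.I * τ / 2)) atImInfty (𝓝 0) := by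
    rw [tendsto_zero_iff_norm_tendsto_zero]
    simp_rw [norm_exp_pi_mul_I_mul, mul_div_right_comm]
    exact Real.tendsto_exp_atBot.comp
      ((tendsto_comap (f := UpperHalfPlane.im)).const_mul_atTop_of_neg
        (by linarith [Real.pi_pos]))
  have h2 := h.mul (tendsto_theta2.pow 2)
  rw [zero_mul] at h2
  exact h2.congr fun τ => (sqrtx2_eq τ).symm

/-- A lower bound for √x₂: it vanishes at i∞ to order no higher than q^{1/4}. The constant 1
suffices because the cofactor tends to 2² and so eventually has norm above 1. -/
theorem exp_isBigO_sqrtx2 :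
    (fun τ : ℍ => Real.exp (-2 * Real.pi * τ.im / 4)) =O[atImInfty] sqrtx2 := by
  have h1 := tendsto_theta2.norm.eventually_const_lt
    (show (1 : ℝ) < ‖(2 : ℂ)‖ by rw [Complex.norm_two]; norm_num)
  refine Asymptotics.IsBigO.of_bound 1 ?_
  filter_upwards [h1] with τ hτ
  rw [sqrtx2_eq, norm_mul, norm_exp_pi_mul_I_mul, norm_pow, Real.norm_eq_abs, Real.abs_exp,
    one_mul]
  exact le_mul_of_one_le_right (Real.exp_pos _).le (one_le_pow₀ hτ.le)

theorem eventually_sqrtx2_ne_zero : ∀ᶠ τ in atImInfty, sqrtx2 τ ≠ 0 := by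
  filter_upwards [tendsto_theta2.eventually_ne two_ne_zero] with τ hτ
  rw [sqrtx2_eq]
  exact mul_ne_zero (Complex.exp_ne_zero _) (pow_ne_zero _ hτ)

end Theta

/-! ### The theta constants have no zeros on ℍ. -/

section Nonvanishing

/-- The product `(θ₂θ₃θ₄)⁸`. -/
def thetaProd (τ : ℍ) : ℂ := (sqrtx2 τ * sqrtx3 τ * sqrtx4 τ) ^ 4

theorem thetaProd_slash_T : thetaProd ∣[(12 : ℤ)] T = thetaProd := by
  ext τ
  rw [slash_T_apply, thetaProd, thetaProd, sqrtx2_one_vadd, sqrtx3_one_vadd, sqrtx4_one_vadd]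
  linear_combination (sqrtx2 τ * sqrtx3 τ * sqrtx4 τ) ^ 4 * Complex.I_pow_four

theorem thetaProd_slash_S : thetaProd ∣[(12 : ℤ)] S = thetaProd := by
  ext τ
  have h0 := τ.ne_zero
  rw [slash_S_apply, thetaProd, thetaProd, sqrtx2_S_smul, sqrtx3_S_smul, sqrtx4_S_smul,
    zpow_neg, ← div_eq_mul_inv, div_eq_iff (zpow_ne_zero _ h0)]
  have hI : Complex.I ^ 12 = 1 := by
    rw [show 12 = 4 * 3 from rfl, pow_mul, Complex.I_pow_four, one_pow]
  rw [show ((τ : ℂ) ^ (12 : ℤ)) = (τ : ℂ) ^ 12 from zpow_natCast _ 12]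
  linear_combination (τ : ℂ) ^ 12 * (sqrtx2 τ * sqrtx3 τ * sqrtx4 τ) ^ 4 * hI

/-- `(θ₂θ₃θ₄)⁸` as a cusp form of level one. -/
def thetaProdCuspForm : CuspForm 𝒮ℒ 12 where
  toFun := thetaProd
  slash_action_eq' A hA := by
    obtain ⟨A, rfl⟩ := hA
    exact SlashInvariantForm.slash_action_generators_SL2Z thetaProd_slash_S thetaProd_slash_T A
  holo' := ((mdifferentiable_sqrtx2.mul mdifferentiable_sqrtx3).mul mdifferentiable_sqrtx4).pow 4
  zero_at_cusps' hc := by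
    rw [Subgroup.IsArithmetic.isCusp_iff_isCusp_SL2Z] at hc
    rw [OnePoint.isZeroAt_iff_forall_SL2Z hc]
    intro γ _
    rw [SlashInvariantForm.slash_action_generators_SL2Z thetaProd_slash_S thetaProd_slash_T]
    have h := (((tendsto_sqrtx2.mul tendsto_sqrtx3).mul tendsto_sqrtx4).pow 4)
    rw [zero_mul, zero_mul, zero_pow four_ne_zero] at h
    exact h

/-- Dividing by the discriminant leaves a level-one form of weight 0, which is a constant. It is
nonzero because all three factors are nonzero near i∞, and the discriminant has no zeros. -/
theorem thetaProd_ne_zero (τ : ℍ) : thetaProd τ ≠ 0 := by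
  obtain ⟨c, hc⟩ := ModularFormClass.levelOne_weight_zero_const
    (F := ModularForm 𝒮ℒ 0) (CuspForm.discriminantEquiv thetaProdCuspForm)
  have h (τ : ℍ) : thetaProd τ = ModularForm.discriminant τ * c := by
    refine (ModularForm.discriminant_mul_discriminantEquiv_apply thetaProdCuspForm τ).symm.trans ?_
    congr 1
    exact congrFun hc τ
  obtain ⟨σ, h2, h3, h4⟩ := (eventually_sqrtx2_ne_zero.and
    ((tendsto_sqrtx3.eventually_ne one_ne_zero).and
      (tendsto_sqrtx4.eventually_ne one_ne_zero))).exists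
  have hc0 : c ≠ 0 := by
    rintro rfl
    have := h σ
    rw [mul_zero] at this
    exact pow_ne_zero 4 (mul_ne_zero (mul_ne_zero h2 h3) h4) this
  rw [h]
  exact mul_ne_zero (ModularForm.discriminant_ne_zero τ) hc0

theorem sqrtx2_ne_zero (τ : ℍ) : sqrtx2 τ ≠ 0 := fun h =>
  thetaProd_ne_zero τ <| by simp [thetaProd, h]

theorem sqrtx3_ne_zero (τ : ℍ) : sqrtx3 τ ≠ 0 := fun h =>
  thetaProd_ne_zero τ <| by simp [thetaProd, h]

end Nonvanishing

/-! ### Generators and coset representatives of Γ¹(4). -/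

section Group

/-- The determinant forces d ≡ 1 once a ≡ 1 and b ≡ 0. Membership thus depends on the top row alone,
on which right multiplication acts. -/
theorem mem_GammaUpper1_four {g : SL(2, ℤ)} :
    g ∈ GammaUpper1 4 ↔ g 0 0 % 4 = 1 ∧ 4 ∣ g 0 1 := by
  have key (a : ℤ) : (a : ZMod 4) = 1 ↔ a % 4 = 1 := by
    rw [← Int.cast_one, ZMod.intCast_eq_intCast_iff]
    rfl
  have h : g ∈ GammaUpper1 4 ↔ (g 0 0 : ZMod 4) = 1 ∧ (g 1 1 : ZMod 4) = 1 ∧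
    (g 0 1 : ZMod 4) = 0 := Iff.rfl
  rw [h, key, key, ZMod.intCast_zmod_eq_zero_iff_dvd]
  refine ⟨fun h => ⟨h.1, h.2.2⟩, fun ⟨h1, h2⟩ => ⟨h1, ?_, h2⟩⟩
  have hdet := g.det_coe
  rw [Matrix.det_fin_two] at hdet
  obtain ⟨b, hb⟩ := h2
  obtain ⟨a, ha⟩ : ∃ a, g 0 0 = 4 * a + 1 := ⟨g 0 0 / 4, by omega⟩
  rw [hb, ha] at hdet
  have : g 1 1 = 1 + 4 * (b * g 1 0 - a * g 1 1) := by linarith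
  omega

theorem finiteIndex_GammaUpper1_four : (GammaUpper1 4).FiniteIndex := by
  refine Subgroup.finiteIndex_of_le (H := CongruenceSubgroup.Gamma 4) fun g hg => ?_
  obtain ⟨h1, h2, h3, h4⟩ := CongruenceSubgroup.Gamma_mem.1 hg
  exact ⟨h1, h4, h2⟩

theorem finiteIndex_Gamma14Two : Gamma14Two.FiniteIndex := by
  unfold Gamma14Two
  infer_instance

/-- The matrix `(1 0; 1 1)`. -/
def lowerOne : SL(2, ℤ) := ⟨!![1, 0; 1, 1], by simp [Matrix.det_fin_two]⟩

theorem coe_lowerOne : (lowerOne : Matrix (Fin 2) (Fin 2) ℤ) = !![1, 0; 1, 1] := rfl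

theorem mul_top_row (g : SL(2, ℤ)) {δ : SL(2, ℤ)} {p q r s : ℤ}
    (h : (δ : Matrix (Fin 2) (Fin 2) ℤ) = !![p, q; r, s]) :
    (g * δ : SL(2, ℤ)) 0 0 = g 0 0 * p + g 0 1 * r ∧
    (g * δ : SL(2, ℤ)) 0 1 = g 0 0 * q + g 0 1 * s := by
  rw [coe_mul, h]
  simp [Matrix.mul_apply, Fin.sum_univ_two]

theorem mul_inv_top_row (g : SL(2, ℤ)) {δ : SL(2, ℤ)} {p q r s : ℤ}
    (h : (δ : Matrix (Fin 2) (Fin 2) ℤ) = !![p, q; r, s]) :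
    (g * δ⁻¹ : SL(2, ℤ)) 0 0 = g 0 0 * s - g 0 1 * r ∧
    (g * δ⁻¹ : SL(2, ℤ)) 0 1 = -(g 0 0 * q) + g 0 1 * p := by
  rw [coe_mul, coe_inv, h, Matrix.adjugate_fin_two_of]
  simp [Matrix.mul_apply, Fin.sum_univ_two, sub_eq_add_neg]

theorem coe_mul_T_zpow (g : SL(2, ℤ)) (n : ℤ) :
    ((g * T ^ n : SL(2, ℤ)) : Matrix (Fin 2) (Fin 2) ℤ) 0 0 = g 0 0 ∧
    ((g * T ^ n : SL(2, ℤ)) : Matrix (Fin 2) (Fin 2) ℤ) 0 1 = g 0 1 + n * g 0 0 := by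
  have := mul_top_row g (coe_T_zpow n)
  rw [this.1, this.2]
  constructor <;> ring

theorem T_zpow_four_mem : T ^ (4 : ℤ) ∈ GammaUpper1 4 := by
  have := coe_mul_T_zpow 1 4
  rw [one_mul] at this
  rw [mem_GammaUpper1_four, this.1, this.2]
  simp

theorem lowerOne_mem : lowerOne ∈ GammaUpper1 4 := by
  rw [mem_GammaUpper1_four]
  simp [lowerOne]

theorem eq_lowerOne_zpow {g : SL(2, ℤ)} (h00 : g 0 0 = 1) (h01 : g 0 1 = 0) :
    g = lowerOne ^ (g 1 0) := by
  have key (n : ℤ) : ((lowerOne ^ n : SL(2, ℤ)) : Matrix (Fin 2) (Fin 2) ℤ) = !![1, 0; n, 1] := by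
    induction n with
    | zero => rw [zpow_zero, Matrix.SpecialLinearGroup.coe_one, Matrix.one_fin_two]
    | succ n h =>
      rw [zpow_add, zpow_one, coe_mul, h, coe_lowerOne, Matrix.mul_fin_two]
      congrm !![?_, ?_; ?_, ?_] <;> ring
    | pred n h =>
      rw [zpow_sub, zpow_one, coe_mul, h, coe_inv, coe_lowerOne, Matrix.adjugate_fin_two_of,
        Matrix.mul_fin_two]
      congrm !![?_, ?_; ?_, ?_] <;> ring
  have hdet := g.det_coe
  rw [Matrix.det_fin_two, h00, h01] at hdet
  apply Matrix.SpecialLinearGroup.ext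
  intro i j
  rw [key]
  fin_cases i <;> fin_cases j <;> simp [h00, h01]
  linarith

/-- Euclid's algorithm on the top row (a, b): right multiplication by (1 0; 1 1)^{±1} replaces a by
a ± b, and by T^{±4} replaces b by b ± 4a. While b ≠ 0 some move lowers |a| + |b|; when b = 0 the
matrix is a power of (1 0; 1 1). -/
theorem GammaUpper1_four_le {H : Subgroup SL(2, ℤ)} (hT : T ^ (4 : ℤ) ∈ H) (hU : lowerOne ∈ H) :
    GammaUpper1 4 ≤ H := by
  suffices h : ∀ (n : ℕ) (g : SL(2, ℤ)), g ∈ GammaUpper1 4 →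
      (g 0 0).natAbs + (g 0 1).natAbs ≤ n → g ∈ H from fun g hg => h _ g hg le_rfl
  intro n
  induction n with
  | zero =>
    intro g hg hn
    rw [mem_GammaUpper1_four] at hg
    omega
  | succ n ih =>
    intro g hg hn
    have descend (u : SL(2, ℤ)) (hu : u ∈ GammaUpper1 4) (huH : u ∈ H)
        (h : ((g * u : SL(2, ℤ)) 0 0).natAbs + ((g * u : SL(2, ℤ)) 0 1).natAbs ≤ n) : g ∈ H :=
      (Subgroup.mul_mem_cancel_right H huH).1 (ih _ (mul_mem hg hu) h)
    have hT1 := coe_mul_T_zpow g 4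
    have hT2 := coe_mul_T_zpow g (-4)
    have hU1 := mul_top_row g coe_lowerOne
    have hU2 := mul_inv_top_row g coe_lowerOne
    have dT1 := descend _ T_zpow_four_mem hT
    have dT2 := descend (T ^ (-4 : ℤ)) (by rw [zpow_neg]; exact inv_mem T_zpow_four_mem)
      (by rw [zpow_neg]; exact inv_mem hT)
    have dU1 := descend _ lowerOne_mem hU
    have dU2 := descend _ (inv_mem lowerOne_mem) (inv_mem hU)
    rw [hT1.1, hT1.2] at dT1
    rw [hT2.1, hT2.2] at dT2
    rw [hU1.1, hU1.2, mul_one, mul_one, mul_zero, zero_add] at dU1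
    rw [hU2.1, hU2.2, mul_one, mul_one, mul_zero, neg_zero, zero_add] at dU2
    rw [mem_GammaUpper1_four] at hg
    have hdet := g.det_coe
    rw [Matrix.det_fin_two] at hdet
    by_cases hb : g 0 1 = 0
    · rw [hb, zero_mul, sub_zero] at hdet
      have ha : g 0 0 = 1 := by
        rcases Int.eq_one_or_neg_one_of_mul_eq_one hdet with h | h <;> omega
      rw [eq_lowerOne_zpow ha hb]
      exact zpow_mem hU _
    · by_cases h1 : (g 0 0 + g 0 1).natAbs + (g 0 1).natAbs ≤ n
      · exact dU1 h1
      by_cases h2 : (g 0 0 - g 0 1).natAbs + (g 0 1).natAbs ≤ n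
      · exact dU2 h2
      by_cases h3 : (g 0 0).natAbs + (g 0 1 + 4 * g 0 0).natAbs ≤ n
      · exact dT1 h3
      -- The first pair of moves helps when |b| < 2|a|, the second when |b| > 2|a|. Equality is
      -- impossible, since a is odd and 4 divides b.
      · exact dT2 (by omega)

/-- Representatives of the cosets of `± Γ¹(4)` in `SL(2, ℤ)`. -/
theorem exists_GammaUpper1_four_mul (γ : SL(2, ℤ)) :
    ∃ g ∈ GammaUpper1 4, (∃ j : ℤ, γ = g * T ^ j ∨ γ = -(g * T ^ j)) ∨
      (γ = g * S ∨ γ = -(g * S)) ∨ (γ = g * kappaMatrix ∨ γ = -(g * kappaMatrix)) := by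
  have hdet := γ.det_coe
  rw [Matrix.det_fin_two] at hdet
  have hneg (g : SL(2, ℤ)) (i j : Fin 2) : (-g) i j = -g i j := by simp
  have hmem (g δ : SL(2, ℤ)) (h : g * δ⁻¹ ∈ GammaUpper1 4 ∨ -(g * δ⁻¹) ∈ GammaUpper1 4) :
      ∃ u ∈ GammaUpper1 4, g = u * δ ∨ g = -(u * δ) := by
    rcases h with h | h
    · exact ⟨_, h, Or.inl (inv_mul_cancel_right g δ).symm⟩
    · exact ⟨_, h, Or.inr (by rw [neg_mul, inv_mul_cancel_right, neg_neg])⟩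
  have hS : ((γ * S⁻¹ : SL(2, ℤ)) 0 0 = -γ 0 1) ∧ ((γ * S⁻¹ : SL(2, ℤ)) 0 1 = γ 0 0) := by
    have := mul_inv_top_row γ (δ := S) rfl
    rw [this.1, this.2]
    constructor <;> ring
  have hκ : ((γ * kappaMatrix⁻¹ : SL(2, ℤ)) 0 0 = -γ 0 1) ∧
      ((γ * kappaMatrix⁻¹ : SL(2, ℤ)) 0 1 = γ 0 0 + 2 * γ 0 1) := by
    have := mul_inv_top_row γ (δ := kappaMatrix) rfl
    rw [this.1, this.2]
    constructor <;> ring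
  -- The entry a modulo 4 determines the cusp: a odd gives ∞, a ≡ 0 gives 0, and a ≡ 2 gives 2.
  rcases Int.even_or_odd (γ 0 0) with ⟨a, ha⟩ | ⟨a, ha⟩
  · have hb : γ 0 1 % 2 = 1 := by
      by_contra hb
      obtain ⟨b, hb⟩ : ∃ b, γ 0 1 = 2 * b := ⟨γ 0 1 / 2, by omega⟩
      rw [ha, hb] at hdet
      have : 2 * (a * γ 1 1 - b * γ 1 0) = 1 := by linarith
      omega
    by_cases h4 : 4 ∣ γ 0 0
    · obtain ⟨u, hu, h⟩ := hmem γ S (by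
        rw [mem_GammaUpper1_four, mem_GammaUpper1_four, hneg, hneg, hS.1, hS.2]
        omega)
      exact ⟨u, hu, Or.inr (Or.inl h)⟩
    · obtain ⟨u, hu, h⟩ := hmem γ kappaMatrix (by
        rw [mem_GammaUpper1_four, mem_GammaUpper1_four, hneg, hneg, hκ.1, hκ.2]
        omega)
      exact ⟨u, hu, Or.inr (Or.inr h)⟩
  -- For odd a, a ≡ ±1 modulo 4 is its own inverse, so j = ±b solves b ≡ ja.
  · obtain ⟨j, hj⟩ : ∃ j : ℤ, 4 ∣ γ 0 1 - j * γ 0 0 := by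
      by_cases h : γ 0 0 % 4 = 1
      · refine ⟨γ 0 1, ?_⟩
        rw [show γ 0 1 - γ 0 1 * γ 0 0 = γ 0 1 * (1 - γ 0 0) by ring]
        exact Dvd.dvd.mul_left (by omega) _
      · refine ⟨-γ 0 1, ?_⟩
        rw [show γ 0 1 - -γ 0 1 * γ 0 0 = γ 0 1 * (1 + γ 0 0) by ring]
        exact Dvd.dvd.mul_left (by omega) _
    have hT := coe_mul_T_zpow γ (-j)
    rw [zpow_neg] at hT
    obtain ⟨u, hu, h⟩ := hmem γ (T ^ j) (by
      rw [mem_GammaUpper1_four, mem_GammaUpper1_four, hneg, hneg, hT.1, hT.2, neg_mul,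
        ← sub_eq_add_neg]
      omega)
    exact ⟨u, hu, Or.inl ⟨j, h⟩⟩

end Group

/-! ### Invariance and boundedness criteria for Γ¹(4), and the theta squares at the cusp 2. -/

section Slash

attribute [local instance] finiteIndex_GammaUpper1_four finiteIndex_Gamma14Two

theorem slash_neg (k : ℤ) (f : ℍ → ℂ) (γ : SL(2, ℤ)) :
    f ∣[k] (-γ) = (-1 : ℂ) ^ (-k) • f ∣[k] γ := by
  ext τ
  rw [Pi.smul_apply, smul_eq_mul, ModularForm.SL_slash_apply, ModularForm.SL_slash_apply,
    ModularGroup.SL_neg_smul]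
  have h : denom (-γ : SL(2, ℤ)) τ = -1 * denom γ τ := by
    rw [denom_apply, denom_apply]
    have hneg (i j : Fin 2) : (-γ) i j = -γ i j := by simp
    rw [hneg, hneg]
    push_cast
    ring
  rw [h, mul_zpow]
  ring

theorem isBoundedAtImInfty_of_tendsto {f : ℍ → ℂ} {c : ℂ} (h : Tendsto f atImInfty (𝓝 c)) :
    IsBoundedAtImInfty f :=
  h.isBigO_one ℝ

theorem _root_.UpperHalfPlane.IsBoundedAtImInfty.div_of_tendsto {f g : ℍ → ℂ} {c : ℂ}
    (hf : IsBoundedAtImInfty f) (hg : Tendsto g atImInfty (𝓝 c)) (hc : c ≠ 0) :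
    IsBoundedAtImInfty (f / g) := by
  rw [div_eq_mul_inv]
  exact hf.mul (isBoundedAtImInfty_of_tendsto (hg.inv₀ hc))

theorem slash_T_zpow_four_apply (k : ℤ) (f : ℍ → ℂ) (τ : ℍ) : (f ∣[k] (T ^ (4 : ℤ))) τ =
    f ((1 : ℝ) +ᵥ (1 : ℝ) +ᵥ (1 : ℝ) +ᵥ (1 : ℝ) +ᵥ τ) := by
  rw [zpow_ofNat, pow_succ, pow_succ, pow_two, SlashAction.slash_mul, SlashAction.slash_mul,
    SlashAction.slash_mul, slash_T_apply, slash_T_apply, slash_T_apply, slash_T_apply]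

/-- (1 0; 1 1) = S T⁻¹ S⁻¹ generates the stabiliser of the cusp 0. Invariance under it can therefore
be read off from f ∣ S, which is needed for boundedness at 0 as well. -/
theorem slash_lowerOne_eq {k : ℤ} {f : ℍ → ℂ} (h : (f ∣[k] S) ∣[k] T = f ∣[k] S) :
    f ∣[k] lowerOne = f := by
  have hU : lowerOne = S * T⁻¹ * S⁻¹ := by
    rw [eq_mul_inv_iff_mul_eq, eq_mul_inv_iff_mul_eq]
    ext i j
    fin_cases i <;> fin_cases j <;> rfl
  rw [hU, SlashAction.slash_mul, SlashAction.slash_mul]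
  nth_rw 1 [← h]
  rw [← SlashAction.slash_mul k T, mul_inv_cancel, SlashAction.slash_one, ← SlashAction.slash_mul,
    mul_inv_cancel, SlashAction.slash_one]

theorem slash_eq_of_mem_GammaUpper1_four {k : ℤ} {f : ℍ → ℂ} (hT : f ∣[k] (T ^ (4 : ℤ)) = f)
    (hS : (f ∣[k] S) ∣[k] T = f ∣[k] S) {g : SL(2, ℤ)} (hg : g ∈ GammaUpper1 4) :
    f ∣[k] g = f := by
  let H : Subgroup SL(2, ℤ) :=
    { carrier := {g | f ∣[k] g = f}
      one_mem' := SlashAction.slash_one k f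
      mul_mem' := fun {a b} (ha : _ = _) (hb : _ = _) => by
        change f ∣[k] (a * b) = f
        rw [SlashAction.slash_mul, ha, hb]
      inv_mem' := fun {a} (ha : _ = _) => by
        change f ∣[k] a⁻¹ = f
        nth_rw 1 [← ha]
        rw [← SlashAction.slash_mul, mul_inv_cancel, SlashAction.slash_one] }
  exact GammaUpper1_four_le (H := H) hT (slash_lowerOne_eq hS) hg

/-- A holomorphic function that is invariant under `Γ¹(4)` and bounded at the three cusps of
`Γ¹(4)` is a modular form. -/
def formOfInvariant {k : ℤ} (f : ℍ → ℂ) (hf : MDiff f)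
    (hinv : ∀ g ∈ GammaUpper1 4, f ∣[k] g = f) (hb : IsBoundedAtImInfty f)
    (hS : IsBoundedAtImInfty (f ∣[k] S)) (hκ : IsBoundedAtImInfty (f ∣[k] kappaMatrix)) :
    MF (GammaUpper1 4) k where
  toFun := f
  slash_action_eq' := by
    rintro _ ⟨g, hg, rfl⟩
    exact hinv g hg
  holo' := hf
  bdd_at_cusps' hc := by
    rw [Subgroup.IsArithmetic.isCusp_iff_isCusp_SL2Z] at hc
    rw [OnePoint.isBoundedAt_iff_forall_SL2Z hc]
    intro γ _
    have key (g δ : SL(2, ℤ)) (hg : g ∈ GammaUpper1 4) (hδ : IsBoundedAtImInfty (f ∣[k] δ))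
        (h : γ = g * δ ∨ γ = -(g * δ)) : IsBoundedAtImInfty (f ∣[k] γ) := by
      rcases h with rfl | rfl
      · rwa [SlashAction.slash_mul, hinv g hg]
      · rw [slash_neg, SlashAction.slash_mul, hinv g hg]
        exact hδ.const_mul_left _
    obtain ⟨g, hg, ⟨j, h⟩ | h | h⟩ := exists_GammaUpper1_four_mul γ
    · refine key g _ hg ?_ h
      rw [ModularForm.SL_slash]
      refine hb.slash k ?_
      change ((((T ^ j : SL(2, ℤ)) : Matrix (Fin 2) (Fin 2) ℤ) 1 0 : ℤ) : ℝ) = 0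
      rw [coe_T_zpow]
      simp
    · exact key g _ hg hS h
    · exact key g _ hg hκ h

theorem kappaPoint_eq (τ : ℍ) : kappaPoint τ = (1 : ℝ) +ᵥ (1 : ℝ) +ᵥ (S • τ) := by
  apply UpperHalfPlane.ext
  have := τ.ne_zero
  rw [coe_one_vadd, coe_one_vadd, coe_S_smul]
  change (2 * (τ : ℂ) - 1) / (τ : ℂ) = _
  field_simp
  ring

theorem sqrtx2_kappaPoint (τ : ℍ) : sqrtx2 (kappaPoint τ) = Complex.I * τ * sqrtx4 τ := by
  rw [kappaPoint_eq, sqrtx2_one_vadd, sqrtx2_one_vadd, sqrtx2_S_smul]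
  linear_combination (-Complex.I * τ * sqrtx4 τ) * Complex.I_sq

theorem sqrtx3_kappaPoint (τ : ℍ) : sqrtx3 (kappaPoint τ) = -Complex.I * τ * sqrtx3 τ := by
  rw [kappaPoint_eq, sqrtx3_one_vadd, sqrtx4_one_vadd, sqrtx3_S_smul]

theorem x2_eq (τ : ℍ) : x2 τ = sqrtx2 τ ^ 2 := by rw [x2, sqrtx2, ← pow_mul]

theorem x3_eq (τ : ℍ) : x3 τ = sqrtx3 τ ^ 2 := by rw [x3, sqrtx3, ← pow_mul]

theorem x4_eq (τ : ℍ) : x4 τ = sqrtx4 τ ^ 2 := by rw [x4, sqrtx4, ← pow_mul]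

end Slash

/-! ### The forms ε̃₁, ε̃₂, √x₂√x₃ and the generation of M(Γ¹(4)). -/

section Generators

attribute [local instance] finiteIndex_GammaUpper1_four finiteIndex_Gamma14Two

theorem sqrtx2_add_sqrtx3_slash_S :
    (sqrtx2 + sqrtx3) ∣[(1 : ℤ)] S = (-Complex.I) • (sqrtx4 + sqrtx3) := by
  rw [SlashAction.add_slash, sqrtx2_slash_S, sqrtx3_slash_S, smul_add]

theorem sqrtx2_add_sqrtx3_slash_kappaMatrix :
    (sqrtx2 + sqrtx3) ∣[(1 : ℤ)] kappaMatrix = (-Complex.I) • (sqrtx3 - sqrtx4) := by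
  rw [slash_kappaMatrix]
  ext τ
  have := τ.ne_zero
  rw [Pi.add_apply, Pi.smul_apply, Pi.sub_apply, smul_eq_mul, sqrtx2_kappaPoint,
    sqrtx3_kappaPoint, zpow_neg_one]
  field_simp
  ring

/-- The form `√x₂ + √x₃` of weight one. -/
def epsilonOne : MF (GammaUpper1 4) 1 :=
  formOfInvariant (sqrtx2 + sqrtx3) (mdifferentiable_sqrtx2.add mdifferentiable_sqrtx3)
    (fun g hg => by
      refine slash_eq_of_mem_GammaUpper1_four ?_ ?_ hg
      · ext τ
        rw [slash_T_zpow_four_apply]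
        simp only [Pi.add_apply, sqrtx2_one_vadd, sqrtx3_one_vadd, sqrtx4_one_vadd]
        linear_combination (sqrtx2 τ) * Complex.I_pow_four
      · rw [sqrtx2_add_sqrtx3_slash_S, ModularForm.SL_smul_slash, SlashAction.add_slash,
          sqrtx4_slash_T, sqrtx3_slash_T, add_comm])
    (isBoundedAtImInfty_of_tendsto (tendsto_sqrtx2.add tendsto_sqrtx3))
    (by
      rw [sqrtx2_add_sqrtx3_slash_S]
      exact (isBoundedAtImInfty_of_tendsto (tendsto_sqrtx4.add tendsto_sqrtx3)).const_mul_left _)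
    (by
      rw [sqrtx2_add_sqrtx3_slash_kappaMatrix]
      exact (isBoundedAtImInfty_of_tendsto (tendsto_sqrtx3.sub tendsto_sqrtx4)).const_mul_left _)

theorem sq_add_sq_slash_S :
    (sqrtx2 ^ 2 + sqrtx3 ^ 2) ∣[(2 : ℤ)] S = -(sqrtx4 ^ 2 + sqrtx3 ^ 2) := by
  ext τ
  have := τ.ne_zero
  rw [slash_S_apply]
  simp only [Pi.add_apply, Pi.pow_apply, Pi.neg_apply, sqrtx2_S_smul, sqrtx3_S_smul]
  rw [zpow_neg, zpow_ofNat]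
  field_simp
  linear_combination (sqrtx4 τ ^ 2 + sqrtx3 τ ^ 2) * Complex.I_sq

theorem sq_add_sq_slash_kappaMatrix :
    (sqrtx2 ^ 2 + sqrtx3 ^ 2) ∣[(2 : ℤ)] kappaMatrix = -(sqrtx3 ^ 2 + sqrtx4 ^ 2) := by
  rw [slash_kappaMatrix]
  ext τ
  have := τ.ne_zero
  simp only [Pi.add_apply, Pi.pow_apply, Pi.neg_apply, sqrtx2_kappaPoint, sqrtx3_kappaPoint]
  rw [zpow_neg, zpow_ofNat]
  field_simp
  linear_combination (sqrtx4 τ ^ 2 + sqrtx3 τ ^ 2) * Complex.I_sq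

/-- The form `x₂ + x₃` of weight two. -/
def epsilonTwo : MF (GammaUpper1 4) 2 :=
  formOfInvariant (sqrtx2 ^ 2 + sqrtx3 ^ 2)
    ((mdifferentiable_sqrtx2.pow 2).add (mdifferentiable_sqrtx3.pow 2))
    (fun g hg => by
      refine slash_eq_of_mem_GammaUpper1_four ?_ ?_ hg
      · ext τ
        rw [slash_T_zpow_four_apply]
        simp only [Pi.add_apply, Pi.pow_apply, sqrtx2_one_vadd, sqrtx3_one_vadd, sqrtx4_one_vadd]
        linear_combination (sqrtx2 τ ^ 2 * (Complex.I ^ 4 + 1)) * Complex.I_pow_four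
      · rw [sq_add_sq_slash_S]
        ext τ
        rw [slash_T_apply]
        simp only [Pi.add_apply, Pi.pow_apply, Pi.neg_apply, sqrtx3_one_vadd, sqrtx4_one_vadd]
        ring)
    (isBoundedAtImInfty_of_tendsto ((tendsto_sqrtx2.pow 2).add (tendsto_sqrtx3.pow 2)))
    (by
      rw [sq_add_sq_slash_S]
      exact isBoundedAtImInfty_of_tendsto ((tendsto_sqrtx4.pow 2).add (tendsto_sqrtx3.pow 2)).neg)
    (by
      rw [sq_add_sq_slash_kappaMatrix]
      exact isBoundedAtImInfty_of_tendsto ((tendsto_sqrtx3.pow 2).add (tendsto_sqrtx4.pow 2)).neg)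

theorem sqrtx2_mul_sqrtx3_slash_S :
    (sqrtx2 * sqrtx3) ∣[(2 : ℤ)] S = -(sqrtx4 * sqrtx3) := by
  ext τ
  have := τ.ne_zero
  rw [slash_S_apply]
  simp only [Pi.mul_apply, Pi.neg_apply, sqrtx2_S_smul, sqrtx3_S_smul]
  rw [zpow_neg, zpow_ofNat]
  field_simp
  linear_combination (sqrtx4 τ * sqrtx3 τ) * Complex.I_sq

theorem sqrtx2_mul_sqrtx3_slash_kappaMatrix :
    (sqrtx2 * sqrtx3) ∣[(2 : ℤ)] kappaMatrix = sqrtx4 * sqrtx3 := by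
  rw [slash_kappaMatrix]
  ext τ
  have := τ.ne_zero
  simp only [Pi.mul_apply, sqrtx2_kappaPoint, sqrtx3_kappaPoint]
  rw [zpow_neg, zpow_ofNat]
  field_simp
  linear_combination (-sqrtx4 τ * sqrtx3 τ) * Complex.I_sq

/-- The form `√x₂ √x₃` of weight two, which vanishes only at the cusp `∞`. -/
def sqrtx2MulSqrtx3 : MF (GammaUpper1 4) 2 :=
  formOfInvariant (sqrtx2 * sqrtx3) (mdifferentiable_sqrtx2.mul mdifferentiable_sqrtx3)
    (fun g hg => by
      refine slash_eq_of_mem_GammaUpper1_four ?_ ?_ hg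
      · ext τ
        rw [slash_T_zpow_four_apply]
        simp only [Pi.mul_apply, sqrtx2_one_vadd, sqrtx3_one_vadd, sqrtx4_one_vadd]
        linear_combination (sqrtx2 τ * sqrtx3 τ) * Complex.I_pow_four
      · rw [sqrtx2_mul_sqrtx3_slash_S]
        ext τ
        rw [slash_T_apply]
        simp only [Pi.mul_apply, Pi.neg_apply, sqrtx3_one_vadd, sqrtx4_one_vadd]
        ring)
    (isBoundedAtImInfty_of_tendsto (tendsto_sqrtx2.mul tendsto_sqrtx3))
    (by
      rw [sqrtx2_mul_sqrtx3_slash_S]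
      exact isBoundedAtImInfty_of_tendsto (tendsto_sqrtx4.mul tendsto_sqrtx3).neg)
    (by
      rw [sqrtx2_mul_sqrtx3_slash_kappaMatrix]
      exact isBoundedAtImInfty_of_tendsto (tendsto_sqrtx4.mul tendsto_sqrtx3))

theorem four_mem_strictPeriods :
    (4 : ℝ) ∈ ((GammaUpper1 4).map (Matrix.SpecialLinearGroup.mapGL ℝ)).strictPeriods := by
  rw [Subgroup.mem_strictPeriods_iff]
  refine ⟨T ^ (4 : ℤ), T_zpow_four_mem, ?_⟩
  ext i j
  change ((((T ^ (4 : ℤ) : SL(2, ℤ)) : Matrix (Fin 2) (Fin 2) ℤ) i j : ℤ) : ℝ) = _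
  rw [coe_T_zpow]
  fin_cases i <;> fin_cases j <;> simp

theorem exp_isBigO_sqrtx2_mul_sqrtx3 :
    (fun τ : ℍ => Real.exp (-2 * Real.pi * τ.im / 4)) =O[atImInfty] (sqrtx2 * sqrtx3) := by
  refine exp_isBigO_sqrtx2.trans ?_
  have h := (Asymptotics.isBigO_refl (sqrtx2 * sqrtx3) atImInfty).mul
    ((tendsto_sqrtx3.inv₀ one_ne_zero).isBigO_one ℂ)
  refine h.congr (fun τ => ?_) fun τ => mul_one _
  exact mul_inv_cancel_right₀ (sqrtx3_ne_zero τ) _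

/-- A form of period 4 that vanishes at ∞ is O(|q^{1/4}|), and √x₂√x₃ is no smaller than that, so
the quotient is bounded at ∞. At the cusps 0 and 2 the divisor tends to -1 and 1, and on ℍ it has no
zeros. -/
theorem exists_eq_mul_of_isZeroAtImInfty {k : ℤ} (f : MF (GammaUpper1 4) k)
    (hf : IsZeroAtImInfty f) : ∃ g : MF (GammaUpper1 4) (k - 2),
      ∀ τ, f τ = sqrtx2MulSqrtx3 τ * g τ := by
  have hD (τ : ℍ) : (sqrtx2 * sqrtx3) τ ≠ 0 := mul_ne_zero (sqrtx2_ne_zero τ) (sqrtx3_ne_zero τ)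
  have hbdd (γ : SL(2, ℤ)) : IsBoundedAtImInfty ((f : ℍ → ℂ) ∣[k] γ) :=
    ModularFormClass.bdd_at_infty_slash f γ
  refine ⟨formOfInvariant ((f : ℍ → ℂ) / (sqrtx2 * sqrtx3))
    (f.holo'.div (mdifferentiable_sqrtx2.mul mdifferentiable_sqrtx3) hD) (fun g hg => ?_) ?_ ?_ ?_,
    fun τ => (mul_div_cancel₀ (f τ) (hD τ)).symm⟩
  · rw [ModularForm.div_slash_SL2]
    congr 1
    · exact f.slash_action_eq' _ (Subgroup.mem_map_of_mem _ hg)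
    · exact sqrtx2MulSqrtx3.slash_action_eq' _ (Subgroup.mem_map_of_mem _ hg)
  · have h := hf.exp_decay_atImInfty four_pos
      (SlashInvariantFormClass.periodic_comp_ofComplex f four_mem_strictPeriods)
      f.holo' (ModularFormClass.bdd_at_infty f)
    exact (Asymptotics.div_isBoundedUnder_of_isBigO
      (h.trans exp_isBigO_sqrtx2_mul_sqrtx3)).isBigO_one ℝ
  · rw [ModularForm.div_slash_SL2, sqrtx2_mul_sqrtx3_slash_S]
    exact (hbdd S).div_of_tendsto (tendsto_sqrtx4.mul tendsto_sqrtx3).neg (by norm_num)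
  · rw [ModularForm.div_slash_SL2, sqrtx2_mul_sqrtx3_slash_kappaMatrix]
    exact (hbdd kappaMatrix).div_of_tendsto (tendsto_sqrtx4.mul tendsto_sqrtx3) (by norm_num)

theorem exists_tendsto_atImInfty {k : ℤ} (f : MF (GammaUpper1 4) k) :
    ∃ c, Tendsto f atImInfty (𝓝 c) := by
  have h := exp_decay_sub_atImInfty four_pos
      (SlashInvariantFormClass.periodic_comp_ofComplex f four_mem_strictPeriods)
      f.holo' (ModularFormClass.bdd_at_infty f)
  have hexp : Tendsto (fun τ : ℍ => Real.exp (-2 * Real.pi * τ.im / 4)) atImInfty (𝓝 0) := by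
    simp_rw [mul_div_right_comm]
    exact Real.tendsto_exp_atBot.comp
      ((tendsto_comap (f := UpperHalfPlane.im)).const_mul_atTop_of_neg
        (by linarith [Real.pi_pos]))
  exact ⟨_, tendsto_sub_nhds_zero_iff.1 (h.trans_tendsto hexp)⟩

/-- Keeping the weight identity as a hypothesis reduces products in the graded ring to pointwise
identities without casts between weights. -/
theorem of_eq_of_mul_of {Γ : Subgroup SL(2, ℤ)} {a b c : ℤ} {f : MF Γ a} {g : MF Γ b} {h : MF Γ c}
    (hc : a + b = c) (H : ∀ τ, h τ = f τ * g τ) :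
    DirectSum.of (MF Γ) c h = DirectSum.of (MF Γ) a f * DirectSum.of (MF Γ) b g := by
  rw [DirectSum.of_mul_of]
  exact DirectSum.of_eq_of_gradedMonoid_eq
    (ModularForm.gradedMonoid_eq_of_cast hc.symm (ModularForm.ext fun τ => H τ))

theorem exists_of_eq_pow {Γ : Subgroup SL(2, ℤ)} (f : MF Γ 1) (n : ℕ) :
    ∃ p : MF Γ n, DirectSum.of (MF Γ) n p = DirectSum.of (MF Γ) 1 f ^ n ∧
      ∀ τ, p τ = f τ ^ n := by
  induction n with
  | zero => exact ⟨(1 : MF Γ 0), rfl, fun τ => (pow_zero _).symm⟩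
  | succ n ih =>
    obtain ⟨p, hp, hp'⟩ := ih
    refine ⟨ModularForm.mcast (by push_cast; rfl) (p.mul f), ?_, fun τ => ?_⟩
    · rw [pow_succ, ← hp]
      exact of_eq_of_mul_of (by push_cast; rfl) fun τ => rfl
    · rw [pow_succ, ← hp']
      rfl

/-- Polarization: 2uv = (u + v)² - (u² + v²) with u = √x₂ and v = √x₃. -/
theorem of_sqrtx2MulSqrtx3 :
    DirectSum.of (MF (GammaUpper1 4)) 2 sqrtx2MulSqrtx3 =
      (1 / 2 : ℂ) • (DirectSum.of (MF (GammaUpper1 4)) 1 epsilonOne ^ 2 -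
        DirectSum.of (MF (GammaUpper1 4)) 2 epsilonTwo) := by
  obtain ⟨p, hp, hp'⟩ := exists_of_eq_pow epsilonOne 2
  rw [← hp]
  change _ = (1 / 2 : ℂ) • (DirectSum.of (MF (GammaUpper1 4)) 2 p - _)
  rw [← map_sub, ← DirectSum.of_smul]
  congr 1
  ext τ
  change sqrtx2 τ * sqrtx3 τ = 1 / 2 * (p τ - (sqrtx2 τ ^ 2 + sqrtx3 τ ^ 2))
  rw [hp']
  change _ = 1 / 2 * ((sqrtx2 τ + sqrtx3 τ) ^ 2 - _)
  ring

theorem of_mem_adjoin_epsilon {k : ℤ} (f : MF (GammaUpper1 4) k) :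
    DirectSum.of (MF (GammaUpper1 4)) k f ∈
      Algebra.adjoin ℂ {DirectSum.of (MF (GammaUpper1 4)) 1 epsilonOne,
        DirectSum.of (MF (GammaUpper1 4)) 2 epsilonTwo} := by
  set A := Algebra.adjoin ℂ {DirectSum.of (MF (GammaUpper1 4)) 1 epsilonOne,
        DirectSum.of (MF (GammaUpper1 4)) 2 epsilonTwo}
  have h1 : DirectSum.of (MF (GammaUpper1 4)) 1 epsilonOne ∈ A :=
    Algebra.subset_adjoin (Set.mem_insert _ _)
  have h2 : DirectSum.of (MF (GammaUpper1 4)) 2 epsilonTwo ∈ A :=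
    Algebra.subset_adjoin (Set.mem_insert_of_mem _ rfl)
  -- The induction is on a strict upper bound for the weight, because each step lowers the weight by
  -- two and may end in a negative weight, where every form is zero.
  suffices h : ∀ (n : ℕ) (k : ℤ) (f : MF (GammaUpper1 4) k), k < n →
      DirectSum.of (MF (GammaUpper1 4)) k f ∈ A from
    h (k.toNat + 1) k f (by omega)
  intro n
  induction n with
  | zero =>
    intro k f hk
    rw [ModularForm.isZero_of_neg_weight hk f, map_zero]
    exact A.zero_mem
  | succ n ih =>
    intro k f hk
    by_cases hk0 : k < 0
    · exact ih k f (by omega)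
    obtain ⟨m, rfl⟩ := Int.eq_ofNat_of_zero_le (not_lt.1 hk0)
    obtain ⟨c, hc⟩ := exists_tendsto_atImInfty f
    obtain ⟨p, hp, hp'⟩ := exists_of_eq_pow epsilonOne m
    -- ε̃₁ tends to 0 + 1 at ∞, so c ε̃₁^m has the same value there as f.
    have hz : IsZeroAtImInfty (f - c • p) := by
      have h := hc.sub ((((tendsto_sqrtx2.add tendsto_sqrtx3).pow m)).const_mul c)
      rw [zero_add, one_pow, mul_one, sub_self] at h
      refine h.congr fun τ => ?_
      change _ = f τ - c * p τ
      rw [hp']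
      rfl
    obtain ⟨g, hg⟩ := exists_eq_mul_of_isZeroAtImInfty (f - c • p) hz
    have h := of_eq_of_mul_of (by ring) hg
    rw [map_sub, DirectSum.of_smul, hp, sub_eq_iff_eq_add] at h
    rw [h]
    refine A.add_mem (A.mul_mem ?_ (ih _ g (by omega))) (A.smul_mem (A.pow_mem h1 _) _)
    rw [of_sqrtx2MulSqrtx3]
    exact A.smul_mem (A.sub_mem (A.pow_mem h1 _) h2) _

theorem adjoin_epsilon_eq_top :
    Algebra.adjoin ℂ {DirectSum.of (MF (GammaUpper1 4)) 1 epsilonOne,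
        DirectSum.of (MF (GammaUpper1 4)) 2 epsilonTwo} = ⊤ := by
  rw [eq_top_iff]
  intro x _
  induction x using DirectSum.induction_on with
  | zero => exact Subalgebra.zero_mem _
  | of k f => exact of_mem_adjoin_epsilon f
  | add x y hx hy => exact Subalgebra.add_mem _ (hx trivial) (hy trivial)

end Generators

/-! ### Surjectivity of κ and the generation of Υ. -/

section Kappa

attribute [local instance] finiteIndex_GammaUpper1_four finiteIndex_Gamma14Two

/-- The matrix `(1 0; 4 1)`. -/
def lowerFour : SL(2, ℤ) := ⟨!![1, 0; 4, 1], by simp [Matrix.det_fin_two]⟩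

theorem lowerFour_mem : lowerFour ∈ Gamma14Two := by
  refine ⟨(CongruenceSubgroup.Gamma1_mem 4 _).2 ⟨?_, ?_, ?_⟩,
    CongruenceSubgroup.Gamma_mem.2 ⟨?_, ?_, ?_, ?_⟩⟩ <;> rfl

/-- The generator T⁴ of Γ¹(4) is conjugated into Γ₁(4) ∩ Γ(2). -/
theorem kappaMatrix_inv_mul_T_zpow :
    kappaMatrix⁻¹ * T ^ (4 : ℤ) = lowerFour⁻¹ * kappaMatrix⁻¹ := by
  rw [eq_inv_mul_iff_mul_eq]
  ext i j
  fin_cases i <;> fin_cases j <;> rfl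

/-- The generator at the cusp 0 is conjugated, up to inversion, to a matrix outside Γ(2). This is
where the condition on φ(τ + 1) in Υ_k is needed. -/
theorem kappaMatrix_inv_mul_S_mul_T :
    kappaMatrix⁻¹ * S * T = -(lowerFour * T⁻¹) * (kappaMatrix⁻¹ * S) := by
  ext i j
  fin_cases i <;> fin_cases j <;> rfl

/-- The preimage of φ is its slash by the inverse matrix; what needs proof is invariance under the
two generators of Γ¹(4). -/
theorem kappa_surjective (k : ℤ) : Function.Surjective (kappa k) := by
  rintro ⟨φ, hφ⟩
  have hmem {A : SL(2, ℤ)} (hA : A ∈ Gamma14Two) : (φ : ℍ → ℂ) ∣[k] A = φ :=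
    φ.slash_action_eq' _ (Subgroup.mem_map_of_mem _ hA)
  have hT : (φ : ℍ → ℂ) ∣[k] T = (-1 : ℂ) ^ k • (φ : ℍ → ℂ) := by
    ext τ
    rw [slash_T_apply, hφ τ]
    rfl
  have hT' : (φ : ℍ → ℂ) ∣[k] T⁻¹ = (-1 : ℂ) ^ (-k) • (φ : ℍ → ℂ) := by
    have h : (φ : ℍ → ℂ) = (-1 : ℂ) ^ (-k) • ((φ : ℍ → ℂ) ∣[k] T) := by
      rw [hT, smul_smul, ← zpow_add₀ (by norm_num), neg_add_cancel, zpow_zero, one_smul]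
    conv_lhs => rw [h]
    rw [ModularForm.SL_smul_slash, ← SlashAction.slash_mul, mul_inv_cancel, SlashAction.slash_one]
  refine ⟨{
    toFun := (φ : ℍ → ℂ) ∣[k] kappaMatrix⁻¹
    slash_action_eq' := by
      rintro _ ⟨g, hg, rfl⟩
      refine slash_eq_of_mem_GammaUpper1_four ?_ ?_ hg
      · rw [← SlashAction.slash_mul, kappaMatrix_inv_mul_T_zpow, SlashAction.slash_mul,
          hmem (inv_mem lowerFour_mem)]
      -- The factor (-1)^{-k} from the matrix -1 cancels the factor (-1)^{-k} by which T⁻¹ acts on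
      -- φ.
      · rw [← SlashAction.slash_mul k kappaMatrix⁻¹ S, ← SlashAction.slash_mul,
          kappaMatrix_inv_mul_S_mul_T,
          SlashAction.slash_mul k (-(lowerFour * T⁻¹)), slash_neg,
          SlashAction.slash_mul k lowerFour, hmem lowerFour_mem, hT', smul_smul, ← mul_zpow]
        norm_num
    holo' := φ.holo'.slash k _
    bdd_at_cusps' := fun hc => by
      rw [Subgroup.IsArithmetic.isCusp_iff_isCusp_SL2Z] at hc
      rw [OnePoint.isBoundedAt_iff_forall_SL2Z hc]
      intro γ _
      rw [← SlashAction.slash_mul]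
      exact ModularFormClass.bdd_at_infty_slash φ _ }, ?_⟩
  apply Subtype.ext
  apply ModularForm.ext
  intro τ
  change (fun τ : ℍ => (τ : ℂ) ^ (-k) * ((φ : ℍ → ℂ) ∣[k] kappaMatrix⁻¹) (kappaPoint τ)) τ = φ τ
  rw [← slash_kappaMatrix, ← SlashAction.slash_mul, inv_mul_cancel, SlashAction.slash_one]

theorem kappa_apply {k : ℤ} (f : MF (GammaUpper1 4) k) (τ : ℍ) :
    (kappa k f : MF Gamma14Two k) τ = (τ : ℂ) ^ (-k) * f (kappaPoint τ) := rfl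

/-- The maps `κ_k` assemble to a homomorphism of graded algebras. -/
def kappaAlgHom : MFRing (GammaUpper1 4) →ₐ[ℂ] MFRing Gamma14Two :=
  DirectSum.toAlgebra ℂ (MF (GammaUpper1 4))
    (fun k => DirectSum.lof ℂ ℤ (MF Gamma14Two) k ∘ₗ (Upsilon k).subtype ∘ₗ kappa k)
    (by
      refine congrArg (DirectSum.of (MF Gamma14Two) 0) (ModularForm.ext fun τ => ?_)
      refine (kappa_apply _ τ).trans ?_
      rw [neg_zero, zpow_zero, one_mul]
      rfl)
    (fun {i j} a b => of_eq_of_mul_of rfl fun τ => by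
      change (τ : ℂ) ^ (-(i + j)) * (a (kappaPoint τ) * b (kappaPoint τ)) =
        (τ : ℂ) ^ (-i) * a (kappaPoint τ) * ((τ : ℂ) ^ (-j) * b (kappaPoint τ))
      rw [neg_add, zpow_add₀ τ.ne_zero]
      ring)

theorem kappaAlgHom_of {k : ℤ} (f : MF (GammaUpper1 4) k) :
    kappaAlgHom (DirectSum.of (MF (GammaUpper1 4)) k f) =
      DirectSum.of (MF Gamma14Two) k (kappa k f) :=
  DirectSum.toAddMonoid_of (fun k => (DirectSum.lof ℂ ℤ (MF Gamma14Two) k ∘ₗ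
    (Upsilon k).subtype ∘ₗ kappa k).toAddMonoidHom) k f

/-- Surjectivity of each κ_k gives the components of weight k ≥ 0; in negative weight both sides are
zero. -/
theorem range_kappaAlgHom : kappaAlgHom.range = UpsilonRing := by
  classical
  apply le_antisymm
  · rintro _ ⟨x, rfl⟩
    change kappaAlgHom x ∈ UpsilonRing
    induction x using DirectSum.induction_on with
    | zero => rw [map_zero]; exact Subalgebra.zero_mem _
    | add x y hx hy => rw [map_add]; exact Subalgebra.add_mem _ hx hy
    | of k f =>
      rw [kappaAlgHom_of]
      rcases lt_or_ge k 0 with hk | hk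
      · rw [ModularForm.isZero_of_neg_weight hk f, map_zero, Submodule.coe_zero, map_zero]
        exact Subalgebra.zero_mem _
      · refine ⟨fun j _ => ?_, fun j hj => DirectSum.of_eq_of_ne _ _ _ (by omega)⟩
        by_cases hjk : j = k
        · subst hjk
          rw [DirectSum.of_eq_same]
          exact (kappa j f).2
        · rw [DirectSum.of_eq_of_ne _ _ _ hjk]
          exact Submodule.zero_mem _
  · rintro x ⟨hx, hx'⟩
    rw [← DirectSum.sum_support_of x]
    refine Subalgebra.sum_mem _ fun k _ => ?_
    rcases lt_or_ge k 0 with hk | hk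
    · rw [hx' k hk, map_zero]
      exact Subalgebra.zero_mem _
    · obtain ⟨ψ, hψ⟩ := kappa_surjective k ⟨x k, hx k hk⟩
      refine ⟨DirectSum.of _ k ψ, ?_⟩
      change kappaAlgHom _ = _
      rw [kappaAlgHom_of, hψ]

/-- The form `√x₃ - √x₄` in `Υ₁`. -/
def epsilonHatOne : Upsilon 1 := Complex.I • kappa 1 epsilonOne

/-- The form `x₃ + x₄` in `Υ₂`. -/
def epsilonHatTwo : Upsilon 2 := -kappa 2 epsilonTwo

theorem kappa_epsilonOne : kappa 1 epsilonOne = (-Complex.I) • epsilonHatOne := by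
  rw [epsilonHatOne, smul_smul, neg_mul, Complex.I_mul_I, neg_neg, one_smul]

theorem kappa_epsilonTwo : kappa 2 epsilonTwo = -epsilonHatTwo := (neg_neg _).symm

/-- Since ε̂₁ is defined through κ₁, it lies in Υ₁ automatically; the theta formula is the part to
be checked. -/
theorem epsilonHatOne_apply (τ : ℍ) :
    (epsilonHatOne : MF Gamma14Two 1) τ = sqrtx3 τ - sqrtx4 τ := by
  have h := congrFun sqrtx2_add_sqrtx3_slash_kappaMatrix τ
  rw [slash_kappaMatrix] at h
  change Complex.I * ((τ : ℂ) ^ (-1 : ℤ) * (sqrtx2 + sqrtx3) (kappaPoint τ)) = _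
  refine (congrArg (Complex.I * ·) h).trans ?_
  change Complex.I * (-Complex.I * (sqrtx3 τ - sqrtx4 τ)) = _
  linear_combination -(sqrtx3 τ - sqrtx4 τ) * Complex.I_sq

theorem epsilonHatTwo_apply (τ : ℍ) : (epsilonHatTwo : MF Gamma14Two 2) τ = x3 τ + x4 τ := by
  have h := congrFun sq_add_sq_slash_kappaMatrix τ
  rw [slash_kappaMatrix] at h
  change -((τ : ℂ) ^ (-2 : ℤ) * (sqrtx2 ^ 2 + sqrtx3 ^ 2) (kappaPoint τ)) = _
  refine (congrArg (- ·) h).trans ?_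
  rw [x3_eq, x4_eq]
  exact neg_neg _

/-- A homomorphism carries generators to generators of its image, and the scalars -i and -1 are
units, so they do not change the generated algebra. -/
theorem adjoin_epsilonHat_eq :
    Algebra.adjoin ℂ {DirectSum.of (MF Gamma14Two) 1 (epsilonHatOne : MF Gamma14Two 1),
      DirectSum.of (MF Gamma14Two) 2 (epsilonHatTwo : MF Gamma14Two 2)} = UpsilonRing := by
  have h1 : kappaAlgHom (DirectSum.of _ 1 epsilonOne) =
      (-Complex.I) • DirectSum.of (MF Gamma14Two) 1 (epsilonHatOne : MF Gamma14Two 1) := by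
    rw [kappaAlgHom_of, kappa_epsilonOne, Submodule.coe_smul, DirectSum.of_smul]
  have h2 : kappaAlgHom (DirectSum.of _ 2 epsilonTwo) =
      -DirectSum.of (MF Gamma14Two) 2 (epsilonHatTwo : MF Gamma14Two 2) := by
    rw [kappaAlgHom_of, kappa_epsilonTwo, Submodule.coe_neg, map_neg]
  rw [← range_kappaAlgHom]
  apply le_antisymm
  · refine Algebra.adjoin_le ?_
    rintro _ (rfl | rfl)
    · refine ⟨Complex.I • DirectSum.of _ 1 epsilonOne, ?_⟩
      change kappaAlgHom _ = _
      rw [map_smul, h1, smul_smul, mul_neg, Complex.I_mul_I, neg_neg, one_smul]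
    · refine ⟨-DirectSum.of _ 2 epsilonTwo, ?_⟩
      change kappaAlgHom _ = _
      rw [map_neg, h2, neg_neg]
  · rw [← Algebra.map_top, ← adjoin_epsilon_eq_top, AlgHom.map_adjoin, Set.image_pair, h1, h2]
    refine Algebra.adjoin_le ?_
    rintro _ (rfl | rfl)
    · exact Subalgebra.smul_mem _ (Algebra.subset_adjoin (Set.mem_insert _ _)) _
    · exact Subalgebra.neg_mem _ (Algebra.subset_adjoin (Set.mem_insert_of_mem _ rfl))

end Kappa

end ThetaRings

end

open ThetaRings in
theorem mainTheorem7 :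
    ∃ (εt₁ : MF (GammaUpper1 4) 1) (εt₂ : MF (GammaUpper1 4) 2)
      (εh₁ : Upsilon 1) (εh₂ : Upsilon 2),
      -- the four modular forms
      (∀ τ, εt₁ τ = sqrtx2 τ + sqrtx3 τ) ∧
      (∀ τ, εt₂ τ = x2 τ + x3 τ) ∧
      (∀ τ, (εh₁ : MF Gamma14Two 1) τ = sqrtx3 τ - sqrtx4 τ) ∧
      (∀ τ, (εh₂ : MF Gamma14Two 2) τ = x3 τ + x4 τ) ∧
      -- `M(Γ¹(4))` is generated by the first two
      Algebra.adjoin ℂ {DirectSum.of (MF (GammaUpper1 4)) 1 εt₁,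
        DirectSum.of (MF (GammaUpper1 4)) 2 εt₂} = ⊤ ∧
      -- the action of `κ` on these generators
      kappa 1 εt₁ = (-Complex.I) • εh₁ ∧
      kappa 2 εt₂ = -εh₂ ∧
      -- `Υ` is generated by the last two
      Algebra.adjoin ℂ {DirectSum.of (MF Gamma14Two) 1 (εh₁ : MF Gamma14Two 1),
        DirectSum.of (MF Gamma14Two) 2 (εh₂ : MF Gamma14Two 2)} = UpsilonRing := by
  refine ⟨epsilonOne, epsilonTwo, epsilonHatOne, epsilonHatTwo, fun _ => rfl, fun τ => ?_,
    epsilonHatOne_apply, epsilonHatTwo_apply, adjoin_epsilon_eq_top, kappa_epsilonOne,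
    kappa_epsilonTwo, adjoin_epsilonHat_eq⟩
  rw [x2_eq, x3_eq]
  rfl
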